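/- A tournament is a set $V$ of vertices with an irreflexive, antisymmetric and complete binary relation $E$ on $V$; write $x\to y$ for $(x,y)\in E$. A set $A\subseteq V$ is *acyclic* if it contains no $3$-cycle $a\to b\to c\to a$, and *autonomous* if for all $x,x'\in A$ and $y\notin A$: $x\to y$ if and only if $x'\to y$. A tournament is *acyclically indecomposable* if no acyclic autonomous set of vertices has more than one element. The *acyclic component* of a vertex $x$ is the union of all acyclic autonomous sets containing $x$; the *acyclic quotient* $\check T$ of a tournament $T$ has as vertices the acyclic components of $T$, with an edge from a component $P$ to a component $Q\neq P$ if $x\to y$ for some $x, y$ whose components are $P$ and $Q$ respectively. Let $C=(A,<)$ be an acyclic tournament, i.e. a strict linear order. Define the following tournaments. * $C_3.C$, the lexicographical product of the $3$-cycle $C_3$ and $C$: the vertex set is $\{0,1,2\}\times A$, and $(i,x)\to(j,y)$ if $x<y$, or $x=y$ and $j\equiv i+1 \pmod 3$. * $V_{[C]}$: the vertex set is $(A\times\{0,1\})\cup\{a\}$ with $a\notin A\times\{0,1\}$; $(x,i)\to(x',i')$ if $x<x'$, or $x=x'$ and $i<i'$; moreover $a\to(x,0)$ and $(x,1)\to a$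 for all $x\in A$. * $T_{[C]},U_{[C]},H_{[C]},K_{[C]}$: the vertex set is $A\times\{0,1\}$. In all four, $(x,0)\to(x,1)$ for every $x\in A$, and $(x,0)\to(y,0)$ for all $x<y$. In addition, for all $x<y$ in $A$: * in $T_{[C]}$: $(y,1)\to(x,0)$, $(y,0)\to(x,1)$, $(x,1)\to(y,1)$; * in $U_{[C]}$: $(x,0)\to(y,1)$, $(x,1)\to(y,0)$, $(y,1)\to(x,1)$; * in $H_{[C]}$: $(y,1)\to(x,0)$, $(x,1)\to(y,0)$, $(x,1)\to(y,1)$; * in $K_{[C]}$: $(y,1)\to(x,0)$, $(x,1)\to(y,0)$, $(y,1)\to(x,1)$. Let $\omega=(\mathbb N,<)$ and let $\omega^*=(\mathbb N,>)$ be its dual. **Theorem.** The twelve structures $$C_3.\omega,\ C_3.\omega^*,\ V_{[\omega]},\ V_{[\omega^*]},\ T_{[\omega]},\ T_{[\omega^*]},\ U_{[\omega]},\ U_{[\omega^*]},\ H_{[\omega]},\ H_{[\omega^*]},\ \check K_{[\omega]},\ K_{[\omega^*]}$$ are countably infinite acyclically indecomposable tournaments, no two of them are isomorphic, and every infinite acyclically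 indecomposable tournament (of any cardinality) contains a subtournament isomorphic to one of them. -/

import Mathlib

universe u v

namespace Morphology

/-- The binary relation `r` on `V` is the edge relation of a tournament: it is irreflexive,
antisymmetric and complete. -/
structure IsTournament {V : Type u} (r : V → V → Prop) : Prop where
  irrefl : ∀ x, ¬ r x x
  antisymm : ∀ x y, r x y → r y x → x = y
  complete : ∀ x y, x ≠ y → r x y ∨ r y x

/-- The set `A` of vertices is acyclic: it contains no `3`-cycle. -/
def IsAcyclicSet {V : Type u} (r : V → V → Prop) (A : Set V) : Prop :=
  ∀ a ∈ A, ∀ b ∈ A, ∀ c ∈ A, ¬ (r a b ∧ r b c ∧ r c a)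

/-- The set `A` of vertices is autonomous. -/
def IsAutonomous {V : Type u} (r : V → V → Prop) (A : Set V) : Prop :=
  ∀ x ∈ A, ∀ x' ∈ A, ∀ y, y ∉ A → (r x y ↔ r x' y)

/-- No acyclic autonomous set of vertices has more than one element. -/
def AcyclicallyIndecomposable {V : Type u} (r : V → V → Prop) : Prop :=
  ∀ A : Set V, IsAcyclicSet r A → IsAutonomous r A → A.Subsingleton

/-- The acyclic component of `x`: the union of all acyclic autonomous sets containing `x`. -/
def acyclicComponent {V : Type u} (r : V → V → Prop) (x : V) : Set V :=
  ⋃₀ {A : Set V | IsAcyclicSet r A ∧ IsAutonomous r A ∧ x ∈ A}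

/-- The vertices of the acyclic quotient: the acyclic components. -/
abbrev AcyclicComponents {V : Type u} (r : V → V → Prop) : Type u :=
  {S : Set V // ∃ x, S = acyclicComponent r x}

/-- The edges of the acyclic quotient: the pairs of distinct acyclic components of the form
`(acyclicComponent r x, acyclicComponent r y)` with `r x y`. -/
def acyclicQuotient {V : Type u} (r : V → V → Prop) (S S' : AcyclicComponents r) : Prop :=
  S ≠ S' ∧ ∃ x y, S.1 = acyclicComponent r x ∧ S'.1 = acyclicComponent r y ∧ r x y

/-- The `3`-cycle `0 → 1 → 2 → 0`. -/
def threeCycle (i j : Fin 3) : Prop := j = i + 1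

/-- The lexicographical product `T.D`: each vertex of `D` is replaced by a copy of `T`. -/
def lexProd {V : Type u} {A : Type v} (t : V → V → Prop) (d : A → A → Prop)
    (e e' : V × A) : Prop :=
  (e.2 = e'.2 ∧ t e.1 e'.1) ∨ d e.2 e'.2

/-- The tournament `C₃.C`. -/
def c3Rel {A : Type u} (c : A → A → Prop) : Fin 3 × A → Fin 3 × A → Prop :=
  lexProd threeCycle c

/-- The tournament `V_[C]` on `A × 2 ∪ {a}`; the extra vertex `a` is `none`. -/
def vRel {A : Type u} (c : A → A → Prop) : Option (A × Fin 2) → Option (A × Fin 2) → Prop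
  | some (x, i), some (x', i') => c x x' ∨ (x = x' ∧ i < i')
  | none, some (_, i') => i' = 0
  | some (_, i), none => i = 1
  | none, none => False

/-- Pairs of elements of `2 × 2`. -/
abbrev Pair : Type := (Fin 2 × Fin 2) × (Fin 2 × Fin 2)

/-- The horizontal pair `h_i`. -/
def hPair (i : Fin 2) : Pair := ((0, i), (1, i))

/-- The vertical pair `v_i`. -/
def vPair (i : Fin 2) : Pair := ((i, 0), (i, 1))

/-- The diagonal pair `d_i`; the addition `i + 1` is modulo `2`. -/
def dPair (i : Fin 2) : Pair := ((0, i), (1, i + 1))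

/-- The directed graph `Δ(C, X)` on `A × 2`. -/
def deltaRel {A : Type u} (c : A → A → Prop) (X : Set Pair) (e e' : A × Fin 2) : Prop :=
  (e.1 = e'.1 ∧ ((0, e.2), (0, e'.2)) ∈ X) ∨
  (c e.1 e'.1 ∧ ((0, e.2), (1, e'.2)) ∈ X) ∨
  (c e'.1 e.1 ∧ ((1, e.2), (0, e'.2)) ∈ X)

/-- The tournament `T_[C]`. -/
def tRel {A : Type u} (c : A → A → Prop) : A × Fin 2 → A × Fin 2 → Prop :=
  deltaRel c {(dPair 0).swap, (dPair 1).swap, hPair 1, hPair 0, vPair 0}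

/-- The tournament `U_[C]`. -/
def uRel {A : Type u} (c : A → A → Prop) : A × Fin 2 → A × Fin 2 → Prop :=
  deltaRel c {dPair 0, dPair 1, (hPair 1).swap, hPair 0, vPair 0}

/-- The tournament `H_[C]`. -/
def hRel {A : Type u} (c : A → A → Prop) : A × Fin 2 → A × Fin 2 → Prop :=
  deltaRel c {(dPair 0).swap, dPair 1, hPair 1, hPair 0, vPair 0}

/-- The tournament `K_[C]`. -/
def kRel {A : Type u} (c : A → A → Prop) : A × Fin 2 → A × Fin 2 → Prop :=
  deltaRel c {(dPair 0).swap, dPair 1, (hPair 1).swap, hPair 0, vPair 0}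

/-- The acyclic tournament `ω`. -/
def omega (m n : ℕ) : Prop := m < n

/-- The dual `ω*` of `ω`. -/
def omegaStar (m n : ℕ) : Prop := n < m

/-- The twelve tournaments, each given by its vertex set and its edge relation. -/
def twelve : Fin 12 → Σ V : Type, V → V → Prop :=
  ![⟨_, c3Rel omega⟩, ⟨_, c3Rel omegaStar⟩,
    ⟨_, vRel omega⟩, ⟨_, vRel omegaStar⟩,
    ⟨_, tRel omega⟩, ⟨_, tRel omegaStar⟩,
    ⟨_, uRel omega⟩, ⟨_, uRel omegaStar⟩,
    ⟨_, hRel omega⟩, ⟨_, hRel omegaStar⟩,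
    ⟨_, acyclicQuotient (kRel omega)⟩, ⟨_, kRel omegaStar⟩]

end Morphology

namespace Morphology

/-! ### Obstructions to an acyclic autonomous set through a given edge -/

section Tournament

variable {V : Type u} {r : V → V → Prop}

/-! Everything rests on a local criterion. For an edge x → y, the interval consisting of x, y and
all z with x → z → y is acyclic and autonomous unless one of four configurations occurs: a 3-cycle
through the edge, a 3-cycle through x → z or z → y with a suitable third vertex outside the
interval, or a 3-cycle strictly between x and y. Conversely such a configuration keeps x and y out
of every common acyclic autonomous set. So indecomposability means that every edge is obstructed
(`edgeObstruction_of_acyclicallyIndecomposable`, `acyclicallyIndecomposable_of_edgeObstruction`),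
and for the explicit tournaments it is checked edge by edge.

For unavoidability (`not_excludesTwelve`), Ramsey's theorem gives a sequence monotone along ω or ω*,
whose edges either all lie in 3-cycles or all avoid them. In the first case, disjoint pairs of the
sequence form a chain of edges x n → y n, each closed to a 3-cycle by some w n. After another use of
Ramsey's theorem, the position of w n relative to x m, y m and w m depends only on the order of n
and m, and each possibility produces one of the twelve (`ExcludesTwelve.false_of_inThreeCycle`). In
the second case, each pair is obstructed by vertices strictly between its ends. The absence of
3-cycles on the sequence forces these vertices to be stacked along the same order
(`ExcludesTwelve.exists_strictMono_stacked`), so that either the first case applies to the pairs x,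
z or z, y, or 3-cycles are stacked into C₃.ω or C₃.ω*.

For non-isomorphism, four properties of finite and infinite in- and out-degrees separate all but
T_[ω], T_[ω*] and the quotient of K_[ω], in which all degrees are infinite. These three are
separated by sources of out-neighbourhoods and sinks of in-neighbourhoods. -/

theorem IsTournament.asymm (hr : IsTournament r) {x y : V} (h : r x y) : ¬ r y x := by
  intro h'
  have := hr.antisymm x y h h'
  subst this
  exact hr.irrefl x h

theorem IsTournament.ne (hr : IsTournament r) {x y : V} (h : r x y) : x ≠ y := by
  rintro rfl
  exact hr.irrefl x h

theorem IsTournament.of_not (hr : IsTournament r) {x y : V} (hne : x ≠ y) (h : ¬ r x y) :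
    r y x :=
  (hr.complete x y hne).resolve_left h

/-- An edge-preserving map from a tournament to a tournament is an embedding. -/
theorem IsTournament.nonempty_relEmbedding {W : Type v} {d : W → W → Prop}
    (hd : IsTournament d) (hr : IsTournament r) (f : W → V)
    (hf : ∀ p q, d p q → r (f p) (f q)) : Nonempty (d ↪r r) := by
  refine ⟨⟨⟨f, ?_⟩, ?_⟩⟩
  · intro p q hpq
    by_contra hne
    rcases hd.complete p q hne with h | h
    · exact hr.ne (hf _ _ h) hpq
    · exact hr.ne (hf _ _ h) hpq.symm
  · intro p q
    refine ⟨fun h => ?_, hf p q⟩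
    by_contra hn
    have hne : p ≠ q := by
      rintro rfl
      exact hr.irrefl _ h
    exact hr.asymm h (hf _ _ (hd.of_not hne hn))

/-- The edge `(x, y)` lies in a `3`-cycle. -/
def InThreeCycle (r : V → V → Prop) (x y : V) : Prop := ∃ w, r y w ∧ r w x

/-- The obstructions to the existence of an acyclic autonomous set containing both ends of the
edge `(x, y)`. -/
def EdgeObstruction (r : V → V → Prop) (x y : V) : Prop :=
  InThreeCycle r x y ∨
  (∃ z w, r x z ∧ r z y ∧ r w x ∧ r w y ∧ r z w) ∨
  (∃ z w, r x z ∧ r z y ∧ r x w ∧ r y w ∧ r w z) ∨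
  (∃ z : Fin 3 → V, (∀ i, r x (z i) ∧ r (z i) y) ∧ ∀ i, r (z i) (z (i + 1)))

theorem not_mem_of_inThreeCycle (hr : IsTournament r) {A : Set V} (hA : IsAcyclicSet r A)
    (hA' : IsAutonomous r A) {x y : V} (hx : x ∈ A) (hy : y ∈ A) (hxy : r x y) :
    ¬ InThreeCycle r x y := by
  rintro ⟨w, hyw, hwx⟩
  by_cases hw : w ∈ A
  · exact hA x hx y hy w hw ⟨hxy, hyw, hwx⟩
  · exact hr.asymm hwx ((hA' x hx y hy w hw).2 hyw)

theorem IsAutonomous.mem (hr : IsTournament r) {A : Set V} (hA' : IsAutonomous r A) {x y z : V}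
    (hx : x ∈ A) (hy : y ∈ A) (hxz : r x z) (hzy : r z y) : z ∈ A := by
  by_contra hz
  exact hr.asymm hzy ((hA' x hx y hy z hz).1 hxz)

theorem not_mem_of_edgeObstruction (hr : IsTournament r) {A : Set V} (hA : IsAcyclicSet r A)
    (hA' : IsAutonomous r A) {x y : V} (hx : x ∈ A) (hy : y ∈ A) (hxy : r x y) :
    ¬ EdgeObstruction r x y := by
  rintro (h | ⟨z, w, h1, h2, h3, h4, h5⟩ | ⟨z, w, h1, h2, h3, h4, h5⟩ | ⟨z, h1, h2⟩)
  · exact not_mem_of_inThreeCycle hr hA hA' hx hy hxy h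
  · exact not_mem_of_inThreeCycle hr hA hA' hx (hA'.mem hr hx hy h1 h2) h1 ⟨w, h5, h3⟩
  · exact not_mem_of_inThreeCycle hr hA hA' (hA'.mem hr hx hy h1 h2) hy h2 ⟨w, h4, h5⟩
  · have hz : ∀ i, z i ∈ A := fun i => hA'.mem hr hx hy (h1 i).1 (h1 i).2
    exact hA _ (hz 0) _ (hz 1) _ (hz 2) ⟨h2 0, h2 1, h2 2⟩

theorem acyclicallyIndecomposable_of_edgeObstruction (hr : IsTournament r)
    (h : ∀ x y, r x y → EdgeObstruction r x y) : AcyclicallyIndecomposable r := by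
  intro A hA hA' x hx y hy
  by_contra hne
  rcases hr.complete x y hne with h' | h'
  · exact not_mem_of_edgeObstruction hr hA hA' hx hy h' (h _ _ h')
  · exact not_mem_of_edgeObstruction hr hA hA' hy hx h' (h _ _ h')

/-- The interval from x to y is a candidate with at least two elements. Since x is its source and y
its sink, a 3-cycle in it must lie strictly between them, which is the fourth obstruction. A vertex
outside that distinguishes two members yields one of the first three. -/
theorem edgeObstruction_of_acyclicallyIndecomposable (hr : IsTournament r)
    (hi : AcyclicallyIndecomposable r) {x y : V} (hxy : r x y) : EdgeObstruction r x y := by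
  by_contra hn
  simp only [EdgeObstruction, not_or] at hn
  obtain ⟨ha, hb, hb', hc⟩ := hn
  simp only [InThreeCycle, not_exists, not_and] at ha hb hb'
  let A : Set V := {z | z = x ∨ z = y ∨ (r x z ∧ r z y)}
  have hxA : x ∈ A := Or.inl rfl
  have hyA : y ∈ A := Or.inr (Or.inl rfl)
  have hxs : ∀ z ∈ A, ¬ r z x := by
    rintro z (rfl | rfl | h)
    · exact hr.irrefl _
    · exact hr.asymm hxy
    · exact hr.asymm h.1
  have hys : ∀ z ∈ A, ¬ r y z := by
    rintro z (rfl | rfl | h)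
    · exact hr.asymm hxy
    · exact hr.irrefl _
    · exact hr.asymm h.2
  have hmid : ∀ z ∈ A, z ≠ x → z ≠ y → r x z ∧ r z y := by
    rintro z (rfl | rfl | h) h1 h2
    · exact (h1 rfl).elim
    · exact (h2 rfl).elim
    · exact h
  refine hr.ne hxy (hi A ?_ ?_ hxA hyA)
  · intro a haA b hbA c hcA ⟨hab, hbc, hca⟩
    have hmid' : ∀ z ∈ A, ∀ s ∈ A, ∀ t ∈ A, r s z → r z t → r x z ∧ r z y := by
      intro z hz s hs t ht hsz hzt
      apply hmid z hz
      · rintro rfl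
        exact hxs s hs hsz
      · rintro rfl
        exact hys t ht hzt
    refine hc ⟨![a, b, c], ?_, ?_⟩
    · intro i
      fin_cases i
      · exact hmid' a haA c hcA b hbA hca hab
      · exact hmid' b hbA a haA c hcA hab hbc
      · exact hmid' c hcA b hbA a haA hbc hca
    · intro i
      fin_cases i
      · exact hab
      · exact hbc
      · exact hca
  · have key : ∀ z ∈ A, ∀ w, w ∉ A → (r x w ↔ r z w) := by
      intro z hz w hw
      have hwx : w ≠ x := fun h => hw (h ▸ hxA)
      have hwy : w ≠ y := fun h => hw (h ▸ hyA)
      have hwz : w ≠ z := fun h => hw (h ▸ hz)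
      have hxy' : r x w ↔ r y w := by
        constructor
        · intro h
          by_contra h'
          exact hw (Or.inr (Or.inr ⟨h, hr.of_not hwy.symm h'⟩))
        · intro h
          by_contra h'
          exact ha w h (hr.of_not hwx.symm h')
      rcases hz with rfl | rfl | hz
      · rfl
      · exact hxy'
      · constructor
        · intro h
          by_contra h'
          exact hb' z w hz.1 hz.2 h (hxy'.1 h) (hr.of_not hwz.symm h')
        · intro h
          by_contra h'
          have h2 : ¬ r y w := fun h'' => h' (hxy'.2 h'')
          exact hb z w hz.1 hz.2 (hr.of_not hwx.symm h') (hr.of_not hwy.symm h2) h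
    intro z hz z' hz' w hw
    exact (key z hz w hw).symm.trans (key z' hz' w hw)

end Tournament

/-- Ramsey's theorem for pairs of natural numbers and finitely many colours. -/
theorem exists_strictMono_homogeneous {κ : Type*} [Finite κ] (c : ℕ → ℕ → κ) :
    ∃ g : ℕ → ℕ, StrictMono g ∧ ∃ k, ∀ n m, n < m → c (g n) (g m) = k := by
  -- Along a nonprincipal ultrafilter, `c n m` has a limit colour `d n` as m varies, and `d` has a
  -- limit colour `k`. Any finite set of indices with `d n = k` can then be prolonged by a larger
  -- such index, joined to all of them in colour `k`.
  let F : Ultrafilter ℕ := Filter.hyperfilter ℕ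
  have pick : ∀ f : ℕ → κ, ∃ k, ∀ᶠ m in F, f m = k := by
    intro f
    have : ∀ᶠ m in F, ∃ k ∈ (Set.univ : Set κ), f m = k :=
      Filter.Eventually.of_forall fun m => ⟨f m, trivial, rfl⟩
    rw [Ultrafilter.eventually_exists_mem_iff Set.finite_univ] at this
    obtain ⟨k, -, hk⟩ := this
    exact ⟨k, hk⟩
  choose d hd using fun n => pick (c n)
  obtain ⟨k, hk⟩ := pick d
  obtain ⟨g, hg, hg'⟩ := exists_seq_of_forall_finset_exists (fun n => d n = k)
    (fun n m => n < m ∧ c n m = k) (by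
      intro s hs
      have h1 : ∀ᶠ m in F, ∀ n ∈ s, n < m ∧ c n m = k := by
        rw [Filter.eventually_all_finset]
        intro n hn
        have h2 : ∀ᶠ m in F, n < m := by
          have : (Filter.hyperfilter ℕ : Filter ℕ) ≤ Filter.atTop :=
            Nat.hyperfilter_le_atTop
          exact this (Filter.eventually_gt_atTop n)
        filter_upwards [h2, hd n] with m hm hm'
        exact ⟨hm, hm'.trans (hs n hn)⟩
      obtain ⟨m, hm⟩ := (hk.and h1).exists
      exact ⟨m, hm⟩)
  exact ⟨g, fun n m h => (hg' n m h).1, k, fun n m h => (hg' n m h).2⟩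

/-! ### The edges of T, U, H and K row by row -/

section Coordinates

variable {A : Type u} (c : A → A → Prop) (x y : A)

theorem tRel_zero_zero : tRel c (x, 0) (y, 0) ↔ c x y := by
  simp [tRel, deltaRel, dPair, hPair, vPair]

theorem tRel_zero_one : tRel c (x, 0) (y, 1) ↔ x = y ∨ c y x := by
  simp [tRel, deltaRel, dPair, hPair, vPair]

theorem tRel_one_zero : tRel c (x, 1) (y, 0) ↔ c y x := by
  simp [tRel, deltaRel, dPair, hPair, vPair]

theorem tRel_one_one : tRel c (x, 1) (y, 1) ↔ c x y := by
  simp [tRel, deltaRel, dPair, hPair, vPair]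

theorem uRel_zero_zero : uRel c (x, 0) (y, 0) ↔ c x y := by
  simp [uRel, deltaRel, dPair, hPair, vPair]

theorem uRel_zero_one : uRel c (x, 0) (y, 1) ↔ x = y ∨ c x y := by
  simp [uRel, deltaRel, dPair, hPair, vPair]

theorem uRel_one_zero : uRel c (x, 1) (y, 0) ↔ c x y := by
  simp [uRel, deltaRel, dPair, hPair, vPair]

theorem uRel_one_one : uRel c (x, 1) (y, 1) ↔ c y x := by
  simp [uRel, deltaRel, dPair, hPair, vPair]

theorem hRel_zero_zero : hRel c (x, 0) (y, 0) ↔ c x y := by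
  simp [hRel, deltaRel, dPair, hPair, vPair]

theorem hRel_zero_one : hRel c (x, 0) (y, 1) ↔ x = y := by
  simp [hRel, deltaRel, dPair, hPair, vPair]

theorem hRel_one_zero : hRel c (x, 1) (y, 0) ↔ c x y ∨ c y x := by
  simp [hRel, deltaRel, dPair, hPair, vPair]

theorem hRel_one_one : hRel c (x, 1) (y, 1) ↔ c x y := by
  simp [hRel, deltaRel, dPair, hPair, vPair]

theorem kRel_zero_zero : kRel c (x, 0) (y, 0) ↔ c x y := by
  simp [kRel, deltaRel, dPair, hPair, vPair]

theorem kRel_zero_one : kRel c (x, 0) (y, 1) ↔ x = y := by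
  simp [kRel, deltaRel, dPair, hPair, vPair]

theorem kRel_one_zero : kRel c (x, 1) (y, 0) ↔ c x y ∨ c y x := by
  simp [kRel, deltaRel, dPair, hPair, vPair]

theorem kRel_one_one : kRel c (x, 1) (y, 1) ↔ c y x := by
  simp [kRel, deltaRel, dPair, hPair, vPair]

end Coordinates

attribute [simp] tRel_zero_zero tRel_zero_one tRel_one_zero tRel_one_one
  uRel_zero_zero uRel_zero_one uRel_one_zero uRel_one_one
  hRel_zero_zero hRel_zero_one hRel_one_zero hRel_one_one
  kRel_zero_zero kRel_zero_one kRel_one_zero kRel_one_one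

/-! ### The constructions yield tournaments -/

section Tournaments

variable {c : ℕ → ℕ → Prop}

theorem isTournament_omega : IsTournament omega :=
  ⟨fun x => by simp [omega], fun x y h h' => by simp only [omega] at h h'; omega,
    fun x y h => by simp only [omega]; omega⟩

theorem isTournament_omegaStar : IsTournament omegaStar :=
  ⟨fun x => by simp [omegaStar], fun x y h h' => by simp only [omegaStar] at h h'; omega,
    fun x y h => by simp only [omegaStar]; omega⟩

theorem isTournament_tRel (hc : IsTournament c) : IsTournament (tRel c) := by
  have h1 := hc.irrefl
  have h2 := hc.antisymm
  have h3 := hc.complete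
  refine ⟨?_, ?_, ?_⟩ <;> simp only [Prod.forall, Fin.forall_fin_two, tRel_zero_zero,
    tRel_zero_one, tRel_one_zero, tRel_one_one, Prod.mk.injEq, ne_eq] <;> grind

theorem isTournament_uRel (hc : IsTournament c) : IsTournament (uRel c) := by
  have h1 := hc.irrefl
  have h2 := hc.antisymm
  have h3 := hc.complete
  refine ⟨?_, ?_, ?_⟩ <;> simp only [Prod.forall, Fin.forall_fin_two, uRel_zero_zero,
    uRel_zero_one, uRel_one_zero, uRel_one_one, Prod.mk.injEq, ne_eq] <;> grind

theorem isTournament_hRel (hc : IsTournament c) : IsTournament (hRel c) := by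
  have h1 := hc.irrefl
  have h2 := hc.antisymm
  have h3 := hc.complete
  refine ⟨?_, ?_, ?_⟩ <;> simp only [Prod.forall, Fin.forall_fin_two, hRel_zero_zero,
    hRel_zero_one, hRel_one_zero, hRel_one_one, Prod.mk.injEq, ne_eq] <;> grind

theorem isTournament_kRel (hc : IsTournament c) : IsTournament (kRel c) := by
  have h1 := hc.irrefl
  have h2 := hc.antisymm
  have h3 := hc.complete
  refine ⟨?_, ?_, ?_⟩ <;> simp only [Prod.forall, Fin.forall_fin_two, kRel_zero_zero,
    kRel_zero_one, kRel_one_zero, kRel_one_one, Prod.mk.injEq, ne_eq] <;> grind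

theorem isTournament_vRel (hc : IsTournament c) : IsTournament (vRel c) := by
  have h1 := hc.irrefl
  have h2 := hc.antisymm
  have h3 := hc.complete
  refine ⟨?_, ?_, ?_⟩ <;> simp only [Option.forall, Prod.forall, Fin.forall_fin_two, vRel,
    Prod.mk.injEq, ne_eq, Option.some.injEq] <;> grind

theorem threeCycle_cases (i j : Fin 3) : i = j ∨ threeCycle i j ∨ threeCycle j i := by
  unfold threeCycle
  revert i j
  decide

theorem not_threeCycle_self (i : Fin 3) : ¬ threeCycle i i := by
  unfold threeCycle
  revert i
  decide

theorem not_threeCycle_swap (i j : Fin 3) (h : threeCycle i j) : ¬ threeCycle j i := by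
  unfold threeCycle at *
  revert i j
  decide

theorem isTournament_c3Rel (hc : IsTournament c) : IsTournament (c3Rel c) := by
  have h1 := hc.irrefl
  have h2 := hc.antisymm
  have h3 := hc.complete
  have h4 := threeCycle_cases
  have h5 := not_threeCycle_self
  have h6 := not_threeCycle_swap
  refine ⟨?_, ?_, ?_⟩ <;> simp only [Prod.forall, c3Rel, lexProd, Prod.mk.injEq, ne_eq] <;> grind

end Tournaments

/-! ### Acyclic indecomposability of the constructions -/

section Indecomposable

variable {c : ℕ → ℕ → Prop}

theorem acyclicallyIndecomposable_c3Rel (hc : IsTournament c) :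
    AcyclicallyIndecomposable (c3Rel c) := by
  apply acyclicallyIndecomposable_of_edgeObstruction (isTournament_c3Rel hc)
  have h3 : ∀ i : Fin 3, i = i + 2 + 1 := by decide
  have h2 : ∀ i : Fin 3, i + 2 = i + 1 + 1 := by decide
  rintro ⟨i, x⟩ ⟨j, y⟩ (⟨h, h'⟩ | h)
  · dsimp only [threeCycle] at h h'
    subst h h'
    exact Or.inl ⟨(i + 2, x), Or.inl ⟨rfl, h2 i⟩, Or.inl ⟨rfl, h3 i⟩⟩
  · exact Or.inr (Or.inl ⟨(i + 1, x), (i + 2, x), Or.inl ⟨rfl, rfl⟩, Or.inr h,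
      Or.inl ⟨rfl, h3 i⟩, Or.inr h, Or.inl ⟨rfl, h2 i⟩⟩)

theorem acyclicallyIndecomposable_vRel (hc : IsTournament c) :
    AcyclicallyIndecomposable (vRel c) := by
  apply acyclicallyIndecomposable_of_edgeObstruction (isTournament_vRel hc)
  have key : ∀ x, InThreeCycle (vRel c) (some (x, 0)) (some (x, 1)) :=
    fun x => ⟨none, by simp [vRel], by simp [vRel]⟩
  simp only [Option.forall, Prod.forall, Fin.forall_fin_two]
  refine ⟨⟨by simp [vRel], fun x => ⟨fun _ => Or.inl ⟨some (x, 1), by simp [vRel], by simp [vRel]⟩,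
    by simp [vRel]⟩⟩, fun x => ⟨⟨by simp [vRel], fun y => ⟨fun h => ?_, fun h => ?_⟩⟩,
    ⟨fun _ => Or.inl ⟨some (x, 0), by simp [vRel], by simp [vRel]⟩, fun y =>
      ⟨fun h => ?_, fun h => ?_⟩⟩⟩⟩
  · have h : c x y := by simpa [vRel] using h
    exact Or.inr (Or.inl ⟨some (x, 1), none, by simp [vRel], by simp [vRel, h], by simp [vRel],
      by simp [vRel], by simp [vRel]⟩)
  · exact Or.inl ⟨none, by simp [vRel], by simp [vRel]⟩
  · have h : c x y := by simpa [vRel] using h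
    exact Or.inr (Or.inl ⟨none, some (x, 0), by simp [vRel], by simp [vRel], by simp [vRel],
      by simp [vRel, h], by simp [vRel]⟩)
  · have h : c x y := by simpa [vRel] using h
    exact Or.inr (Or.inr (Or.inl ⟨some (y, 0), none, by simp [vRel, h], by simp [vRel],
      by simp [vRel], by simp [vRel], by simp [vRel]⟩))

theorem acyclicallyIndecomposable_tRel (hc : IsTournament c)
    (hc' : (∀ x, ∃ y, c x y) ∨ ∀ x, ∃ y, c y x) (htr : ∀ x y z, c x y → c y z → c x z) :
    AcyclicallyIndecomposable (tRel c) := by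
  apply acyclicallyIndecomposable_of_edgeObstruction (isTournament_tRel hc)
  simp only [Prod.forall, Fin.forall_fin_two, tRel_zero_zero,
    tRel_zero_one, tRel_one_zero, tRel_one_one]
  have key : ∀ x y, x = y ∨ c y x → InThreeCycle (tRel c) (x, 0) (y, 1) := by
    intro x y hxy
    rcases hc' with h | h
    · obtain ⟨z, hz⟩ := h x
      exact ⟨(z, 1), by simp; grind, by simp [hz]⟩
    · obtain ⟨z, hz⟩ := h y
      exact ⟨(z, 0), by simp [hz], by simp; grind⟩
  refine fun x => ⟨fun y => ⟨fun h => Or.inl ⟨(y, 1), by simp, by simp [h]⟩,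
    fun h => Or.inl (key x y h)⟩, fun y => ⟨fun h => Or.inl ⟨(x, 0), by simp [h], by simp⟩,
    fun h => Or.inl ⟨(x, 0), by simp [h], by simp⟩⟩⟩

theorem acyclicallyIndecomposable_uRel (hc : IsTournament c)
    (hc' : (∀ x, ∃ y, c x y) ∨ ∀ x, ∃ y, c y x) :
    AcyclicallyIndecomposable (uRel c) := by
  apply acyclicallyIndecomposable_of_edgeObstruction (isTournament_uRel hc)
  simp only [Prod.forall, Fin.forall_fin_two, uRel_zero_zero,
    uRel_zero_one, uRel_one_zero, uRel_one_one]
  refine fun x => ⟨fun y => ⟨fun h => ?_, fun h => ?_⟩, fun y => ⟨fun h => ?_, fun h => ?_⟩⟩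
  · exact Or.inr (Or.inr (Or.inl ⟨(x, 1), (y, 1), by simp, by simp [h], by simp [h], by simp,
      by simp [h]⟩))
  · rcases h with rfl | h
    · rcases hc' with hc' | hc'
      · obtain ⟨z, hz⟩ := hc' x
        exact Or.inr (Or.inr (Or.inl ⟨(z, 1), (z, 0), by simp [hz], by simp [hz], by simp [hz],
          by simp [hz], by simp⟩))
      · obtain ⟨z, hz⟩ := hc' x
        exact Or.inl ⟨(z, 1), by simp [hz], by simp [hz]⟩
    · exact Or.inr (Or.inr (Or.inl ⟨(y, 0), (x, 1), by simp [h], by simp, by simp,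
        by simp [h], by simp [h]⟩))
  · exact Or.inl ⟨(y, 1), by simp, by simp [h]⟩
  · exact Or.inl ⟨(x, 0), by simp [h], by simp⟩

theorem acyclicallyIndecomposable_hRel (hc : IsTournament c)
    (hc' : (∀ x y, ∃ z, c x z ∧ c y z) ∨ ∀ x y, ∃ z, c z x ∧ c z y) :
    AcyclicallyIndecomposable (hRel c) := by
  apply acyclicallyIndecomposable_of_edgeObstruction (isTournament_hRel hc)
  simp only [Prod.forall, Fin.forall_fin_two, hRel_zero_zero,
    hRel_zero_one, hRel_one_zero, hRel_one_one]
  refine fun x => ⟨fun y => ⟨fun h => ?_, fun h => ?_⟩, fun y => ⟨fun h => ?_, fun h => ?_⟩⟩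
  · exact Or.inl ⟨(y, 1), by simp, by simp [h]⟩
  · subst h
    rcases hc' with hc' | hc'
    · obtain ⟨z, hz, -⟩ := hc' x x
      exact Or.inl ⟨(z, 1), by simp [hz], by simp [hz]⟩
    · obtain ⟨z, hz, -⟩ := hc' x x
      exact Or.inl ⟨(z, 0), by simp [hz], by simp [hz]⟩
  · rcases hc' with hc' | hc'
    · obtain ⟨z, hz, hz'⟩ := hc' x y
      exact Or.inr (Or.inr (Or.inl ⟨(z, 1), (z, 0), by simp [hz], by simp [hz'], by simp [hz],
        by simp [hz'], by simp⟩))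
    · obtain ⟨z, hz, hz'⟩ := hc' x y
      exact Or.inr (Or.inl ⟨(z, 0), (z, 1), by simp [hz], by simp [hz'], by simp [hz],
        by simp [hz'], by simp⟩)
  · exact Or.inl ⟨(x, 0), by simp [h], by simp⟩

/-- Only a vertical edge needs a third vertex from another column, and that column must lie below.
This is why the least column of K_[ω] collapses in the quotient while K_[ω*], having no least
column, is already indecomposable. -/
theorem inThreeCycle_kRel (p q : ℕ × Fin 2) (hpq : kRel c p q)
    (h : p.1 = q.1 → ∃ z, c z p.1) : InThreeCycle (kRel c) p q := by
  obtain ⟨x, i⟩ := p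
  obtain ⟨y, j⟩ := q
  revert i j
  simp only [Fin.forall_fin_two, kRel_zero_zero, kRel_zero_one, kRel_one_zero, kRel_one_one]
  refine ⟨⟨fun h _ => ?_, fun h h' => ?_⟩, ⟨fun h _ => ?_, fun h _ => ?_⟩⟩
  · exact ⟨(y, 1), by simp, by simp [h]⟩
  · obtain ⟨z, hz⟩ := h' h
    subst h
    exact ⟨(z, 1), by simp [hz], by simp [hz]⟩
  · rcases h with h | h
    · exact ⟨(y, 1), by simp, by simp [h]⟩
    · exact ⟨(x, 0), by simp [h], by simp⟩
  · exact ⟨(x, 0), by simp [h], by simp⟩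

theorem acyclicallyIndecomposable_kRel (hc : IsTournament c) (hc' : ∀ x, ∃ y, c y x) :
    AcyclicallyIndecomposable (kRel c) :=
  acyclicallyIndecomposable_of_edgeObstruction (isTournament_kRel hc) fun p q h =>
    Or.inl (inThreeCycle_kRel p q h fun _ => hc' _)

end Indecomposable

/-! ### The acyclic quotient of K_[ω] -/

section Quotient

/-- The tournament obtained from `K_[ω]` by deleting `(0, 1)`. -/
def kTruncRel (p q : {p : ℕ × Fin 2 // p ≠ (0, 1)}) : Prop := kRel omega p q

theorem isTournament_kTruncRel : IsTournament kTruncRel := by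
  have h := isTournament_kRel isTournament_omega
  exact ⟨fun p => h.irrefl _, fun p q h1 h2 => Subtype.ext (h.antisymm _ _ h1 h2),
    fun p q hpq => h.complete _ _ fun h' => hpq (Subtype.ext h')⟩

theorem acyclicallyIndecomposable_kTruncRel : AcyclicallyIndecomposable kTruncRel := by
  apply acyclicallyIndecomposable_of_edgeObstruction isTournament_kTruncRel
  simp only [Subtype.forall, Prod.forall, Fin.forall_fin_two, kTruncRel, kRel_zero_zero,
    kRel_zero_one, kRel_one_zero, kRel_one_one, Prod.mk.injEq, ne_eq, omega, and_true]
  refine fun x => ⟨fun hx y => ⟨fun hy h => ?_, fun hy h => ?_⟩,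
    fun hx y => ⟨fun hy h => ?_, fun hy h => ?_⟩⟩
  · exact Or.inl ⟨⟨(y, 1), by simp; omega⟩, by simp [kTruncRel],
      by simp [kTruncRel, omega]; omega⟩
  -- A vertical edge remains only in a column x ≠ 0, and the surviving vertex (0, 0) of the least
  -- column closes it to a 3-cycle.
  · exact Or.inl ⟨⟨(0, 0), by simp⟩, by simp [kTruncRel, omega]; omega,
      by simp [kTruncRel, omega]; omega⟩
  · rcases h with h | h
    · exact Or.inl ⟨⟨(y, 1), by simp; omega⟩, by simp [kTruncRel],
        by simp [kTruncRel, omega]; omega⟩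
    · exact Or.inl ⟨⟨(x, 0), by simp⟩, by simp [kTruncRel, omega]; omega, by simp [kTruncRel]⟩
  · exact Or.inl ⟨⟨(x, 0), by simp⟩, by simp [kTruncRel, omega]; omega, by simp [kTruncRel]⟩

theorem mem_acyclicComponent_self {V : Type u} {r : V → V → Prop} (hr : IsTournament r) (x : V) :
    x ∈ acyclicComponent r x := by
  refine ⟨{x}, ⟨?_, ?_, rfl⟩, rfl⟩
  · rintro a rfl b rfl c rfl ⟨h, -⟩
    exact hr.irrefl _ h
  · rintro a rfl b rfl y -
    rfl

/-- Every edge other than (0, 0) → (0, 1) lies in a 3-cycle, so its ends share no acyclic autonomous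
set. -/
theorem eq_of_mem_acyclicComponent_kRel {p q : ℕ × Fin 2}
    (h : q ∈ acyclicComponent (kRel omega) p) : p = q ∨ p.1 = 0 ∧ q.1 = 0 := by
  obtain ⟨A, ⟨hA, hA', hp⟩, hq⟩ := h
  by_contra hn
  push Not at hn
  have hK := isTournament_kRel isTournament_omega
  rcases hK.complete p q hn.1 with h | h
  · exact not_mem_of_inThreeCycle hK hA hA' hp hq h (inThreeCycle_kRel p q h fun h' =>
      ⟨0, by simp only [omega]; omega⟩)
  · exact not_mem_of_inThreeCycle hK hA hA' hq hp h (inThreeCycle_kRel q p h fun h' =>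
      ⟨0, by simp only [omega]; omega⟩)

theorem acyclicComponent_kRel_zero {p : ℕ × Fin 2} (hp : p.1 = 0) :
    acyclicComponent (kRel omega) p = {q | q.1 = 0} := by
  have hK := isTournament_kRel isTournament_omega
  ext q
  refine ⟨fun h => ?_, fun h => ?_⟩
  · rcases eq_of_mem_acyclicComponent_kRel h with rfl | h
    · exact hp
    · exact h.2
  · refine ⟨{q | q.1 = 0}, ⟨?_, ?_, hp⟩, h⟩
    · simp only [IsAcyclicSet, Set.mem_ofPred_eq, Prod.forall, Fin.forall_fin_two]
      simp only [kRel_zero_zero, kRel_zero_one, kRel_one_zero, kRel_one_one, omega]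
      repeat' first | intro _ | refine And.intro ?_ ?_
      all_goals omega
    · simp only [IsAutonomous, Set.mem_ofPred_eq, Prod.forall, Fin.forall_fin_two]
      simp [omega]
      grind

theorem acyclicComponent_kRel_injective (p q : {p : ℕ × Fin 2 // p ≠ (0, 1)})
    (h : acyclicComponent (kRel omega) p.1 = acyclicComponent (kRel omega) q.1) : p = q := by
  have hK := isTournament_kRel isTournament_omega
  have hq : q.1 ∈ acyclicComponent (kRel omega) p.1 := by
    rw [h]
    exact mem_acyclicComponent_self hK _
  apply Subtype.ext
  rcases eq_of_mem_acyclicComponent_kRel hq with h | ⟨h1, h2⟩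
  · exact h
  · obtain ⟨⟨x, i⟩, hp⟩ := p
    obtain ⟨⟨y, j⟩, hq⟩ := q
    dsimp only at h1 h2
    subst h1 h2
    revert i j
    simp [Fin.forall_fin_two]

/-- The acyclic quotient of `K_[ω]` is `K_[ω]` with `(0, 1)` deleted. -/
theorem nonempty_kTruncRel_relIso :
    Nonempty (kTruncRel ≃r acyclicQuotient (kRel omega)) := by
  have hK := isTournament_kRel isTournament_omega
  let f : {p : ℕ × Fin 2 // p ≠ (0, 1)} → AcyclicComponents (kRel omega) :=
    fun p => ⟨acyclicComponent (kRel omega) p.1, p.1, rfl⟩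
  have hinj : Function.Injective f := fun p q h =>
    acyclicComponent_kRel_injective p q (congrArg Subtype.val h)
  have hsurj : Function.Surjective f := by
    rintro ⟨S, p, rfl⟩
    by_cases hp : p = (0, 1)
    · refine ⟨⟨(0, 0), by simp⟩, Subtype.ext ?_⟩
      subst hp
      change acyclicComponent _ _ = acyclicComponent _ _
      rw [acyclicComponent_kRel_zero rfl, acyclicComponent_kRel_zero rfl]
    · exact ⟨⟨p, hp⟩, rfl⟩
  refine ⟨⟨Equiv.ofBijective f ⟨hinj, hsurj⟩, ?_⟩⟩
  intro p q
  constructor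
  · rintro ⟨hne, x, y, hx, hy, hxy⟩
    have hne' : p ≠ q := fun h => hne (by rw [h])
    have hpx : p.1 = x ∨ p.1.1 = 0 ∧ x.1 = 0 := by
      apply eq_of_mem_acyclicComponent_kRel
      change x ∈ (f p).1
      rw [show (f p).1 = _ from hx]
      exact mem_acyclicComponent_self hK _
    have hqy : q.1 = y ∨ q.1.1 = 0 ∧ y.1 = 0 := by
      apply eq_of_mem_acyclicComponent_kRel
      change y ∈ (f q).1
      rw [show (f q).1 = _ from hy]
      exact mem_acyclicComponent_self hK _
    obtain ⟨⟨a, i⟩, hp⟩ := p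
    obtain ⟨⟨b, j⟩, hq⟩ := q
    obtain ⟨x, i'⟩ := x
    obtain ⟨y, j'⟩ := y
    clear hx hy hne hinj hsurj f
    revert i j i' j'
    simp only [Fin.forall_fin_two, kTruncRel, kRel_zero_zero, kRel_zero_one, kRel_one_zero,
      kRel_one_one, omega, Prod.mk.injEq, ne_eq, Subtype.mk.injEq, zero_ne_one, one_ne_zero,
      and_true, and_false, not_false_eq_true, false_or]
    repeat' first | intro _ | refine And.intro ?_ ?_
    all_goals omega
  · intro h
    refine ⟨fun h' => ?_, p.1, q.1, rfl, rfl, h⟩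
    have := hinj h'
    subst this
    exact hK.irrefl _ h

end Quotient

/-- None of the twelve tournaments embeds into `r`. -/
def ExcludesTwelve {V : Type u} (r : V → V → Prop) : Prop :=
  ∀ i : Fin 12, ¬ Nonempty ((twelve i).2 ↪r r)

/-- The pairs `(x n, y n)` are edges, and they are stacked along `c`. -/
structure IsBlockChain {V : Type u} (r : V → V → Prop) (c : ℕ → ℕ → Prop) (x y : ℕ → V) :
    Prop where
  pair : ∀ n, r (x n) (y n)
  xx : ∀ n m, c n m → r (x n) (x m)
  xy : ∀ n m, c n m → r (x n) (y m)
  yx : ∀ n m, c n m → r (y n) (x m)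
  yy : ∀ n m, c n m → r (y n) (y m)

/-! ### Configurations that contain one of the twelve -/

section Excluded

variable {V : Type u} {r : V → V → Prop} {c : ℕ → ℕ → Prop}

theorem map_strictMono (hc : c = omega ∨ c = omegaStar) {g : ℕ → ℕ} (hg : StrictMono g) {n m : ℕ}
    (h : c n m) : c (g n) (g m) := by
  rcases hc with rfl | rfl
  · exact hg h
  · exact hg h

theorem IsBlockChain.comp (hc : c = omega ∨ c = omegaStar) {x y : ℕ → V}
    (h : IsBlockChain r c x y) {g : ℕ → ℕ} (hg : StrictMono g) :
    IsBlockChain r c (fun n => x (g n)) (fun n => y (g n)) :=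
  ⟨fun _ => h.pair _, fun _ _ h' => h.xx _ _ (map_strictMono hc hg h'),
    fun _ _ h' => h.xy _ _ (map_strictMono hc hg h'),
    fun _ _ h' => h.yx _ _ (map_strictMono hc hg h'),
    fun _ _ h' => h.yy _ _ (map_strictMono hc hg h')⟩

theorem strictMono_add_one : StrictMono fun n : ℕ => n + 1 := fun _ _ h => Nat.succ_lt_succ h

theorem ExcludesTwelve.false_of_c3 (hx : ExcludesTwelve r) (hr : IsTournament r)
    (hc : c = omega ∨ c = omegaStar) (z : Fin 3 → ℕ → V) (hz : ∀ i n, r (z i n) (z (i + 1) n))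
    (h : ∀ i j n m, c n m → r (z i n) (z j m)) : False := by
  have key : ∀ p q : Fin 3 × ℕ, c3Rel c p q → r (z p.1 p.2) (z q.1 q.2) := by
    rintro ⟨i, n⟩ ⟨j, m⟩ (⟨h1, h2⟩ | h1)
    · dsimp only [threeCycle] at h1 h2
      subst h1 h2
      exact hz _ _
    · exact h _ _ _ _ h1
  rcases hc with rfl | rfl
  · exact hx 0 ((isTournament_c3Rel isTournament_omega).nonempty_relEmbedding hr _ key)
  · exact hx 1 ((isTournament_c3Rel isTournament_omegaStar).nonempty_relEmbedding hr _ key)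

theorem ExcludesTwelve.false_of_v (hx : ExcludesTwelve r) (hr : IsTournament r)
    (hc : c = omega ∨ c = omegaStar) {x y : ℕ → V} (h : IsBlockChain r c x y) (a : V)
    (hax : ∀ n, r a (x n)) (hya : ∀ n, r (y n) a) : False := by
  let f : Option (ℕ × Fin 2) → V := fun p => p.elim a fun q => ![x q.1, y q.1] q.2
  have key : ∀ p q, vRel c p q → r (f p) (f q) := by
    have h1 := h.pair
    have h2 := h.xx
    have h3 := h.xy
    have h4 := h.yx
    have h5 := h.yy
    simp only [Option.forall, Prod.forall, Fin.forall_fin_two, f, vRel]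
    simp
    grind
  rcases hc with rfl | rfl
  · exact hx 2 ((isTournament_vRel isTournament_omega).nonempty_relEmbedding hr _ key)
  · exact hx 3 ((isTournament_vRel isTournament_omegaStar).nonempty_relEmbedding hr _ key)

/-- A tournament excluding the twelve has no vertex alternating along a block chain. -/
theorem ExcludesTwelve.false_of_v' (hx : ExcludesTwelve r) (hr : IsTournament r)
    (hc : c = omega ∨ c = omegaStar) {x y : ℕ → V} (h : IsBlockChain r c x y) (a : V)
    (hxa : ∀ n, r (x n) a) (hay : ∀ n, r a (y n)) : False := by
  have hs : ∀ n, n < n + 1 := fun n => n.lt_succ_self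
  rcases hc with rfl | rfl
  -- Re-pairing the end of each block with the start of the next reverses the role of `a`. Along ω
  -- the next block has index n + 1; along ω* it is the block n + 1 that comes first.
  · refine hx.false_of_v hr (Or.inl rfl) (x := y) (y := fun n => x (n + 1))
      ⟨fun n => h.yx _ _ (hs n), h.yy, fun n m hnm => h.yx _ _ (Nat.lt_succ_of_lt hnm),
        fun n m hnm => ?_, fun n m hnm => h.xx _ _ (Nat.succ_lt_succ hnm)⟩ a hay fun n => hxa _
    rcases Nat.lt_or_ge (n + 1) m with h' | h'
    · exact h.xy _ _ h'
    · obtain rfl : m = n + 1 := le_antisymm h' hnm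
      exact h.pair _
  · refine hx.false_of_v hr (Or.inr rfl) (x := fun n => y (n + 1)) (y := x)
      ⟨fun n => h.yx _ _ (hs n), fun n m hnm => h.yy _ _ (Nat.succ_lt_succ hnm),
        fun n m hnm => h.yx _ _ (Nat.lt_succ_of_lt hnm),
        fun n m hnm => ?_, h.xx⟩ a (fun n => hay _) hxa
    rcases Nat.lt_or_ge (m + 1) n with h' | h'
    · exact h.xy _ _ h'
    · obtain rfl : n = m + 1 := le_antisymm h' hnm
      exact h.pair _

variable {f g : ℕ → V}

/-- The sequence `f` is increasing along `ω` or `ω*`. -/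
def IsMonotoneSeq (r : V → V → Prop) (f : ℕ → V) : Prop :=
  (∀ n m, n < m → r (f n) (f m)) ∨ ∀ n m, n < m → r (f m) (f n)

/-- The edges between the two rows are exactly those common to H and K, in either index order. The
directions of the rows select the tournament: equal directions give H, opposite ones give K. -/
theorem ExcludesTwelve.false_of_eq (hx : ExcludesTwelve r) (hr : IsTournament r)
    (hf : IsMonotoneSeq r f) (hg : IsMonotoneSeq r g) (hfg : ∀ n, r (f n) (g n))
    (hgf : ∀ n m, n ≠ m → r (g n) (f m)) : False := by
  let e : ℕ × Fin 2 → V := fun q => ![f q.1, g q.1] q.2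
  rcases hf with hf | hf <;> rcases hg with hg | hg
  · refine hx 8 ((isTournament_hRel isTournament_omega).nonempty_relEmbedding hr e ?_)
    simp [Fin.forall_fin_two, omega, e]
    grind
  · have h : Nonempty (kRel omega ↪r r) := by
      refine (isTournament_kRel isTournament_omega).nonempty_relEmbedding hr e ?_
      simp [Fin.forall_fin_two, omega, e]
      grind
    obtain ⟨h⟩ := h
    obtain ⟨h'⟩ := nonempty_kTruncRel_relIso
    have h2 : kTruncRel ↪r kRel omega := ⟨Function.Embedding.subtype _, Iff.rfl⟩
    -- K_[ω] is not itself on the list, but its quotient embeds in it, being a copy of K_[ω] minus a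
    -- vertex.
    exact hx 10 ⟨(h'.symm.toRelEmbedding.trans h2).trans h⟩
  · refine hx 11 ((isTournament_kRel isTournament_omegaStar).nonempty_relEmbedding hr e ?_)
    simp [Fin.forall_fin_two, omegaStar, e]
    grind
  · refine hx 9 ((isTournament_hRel isTournament_omegaStar).nonempty_relEmbedding hr e ?_)
    simp [Fin.forall_fin_two, omegaStar, e]
    grind

/-- Edges between the rows agree with the linear order f 0, g 0, f 1, g 1, …. If both rows run
against it, T_[ω*] appears; if exactly one does, U_[ω] appears. -/
theorem ExcludesTwelve.of_le (hx : ExcludesTwelve r) (hr : IsTournament r)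
    (hf : IsMonotoneSeq r f) (hg : IsMonotoneSeq r g) (hfg : ∀ n m, n ≤ m → r (f n) (g m))
    (hgf : ∀ n m, n < m → r (g n) (f m)) :
    (∀ n m, n < m → r (f n) (f m)) ∧ ∀ n m, n < m → r (g n) (g m) := by
  rcases hf with hf | hf <;> rcases hg with hg | hg
  · exact ⟨hf, hg⟩
  · let e : ℕ × Fin 2 → V := fun q => ![f q.1, g q.1] q.2
    refine (hx 6 ((isTournament_uRel isTournament_omega).nonempty_relEmbedding hr e ?_)).elim
    simp [Fin.forall_fin_two, omega, e]
    grind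
  -- Row 0 of U_[ω] must be the increasing one, here g. Dropping f 0 makes the interleaving start
  -- with g.
  · let e : ℕ × Fin 2 → V := fun q => ![g q.1, f (q.1 + 1)] q.2
    refine (hx 6 ((isTournament_uRel isTournament_omega).nonempty_relEmbedding hr e ?_)).elim
    simp [Fin.forall_fin_two, omega, e]
    grind
  · let e : ℕ × Fin 2 → V := fun q => ![f q.1, g q.1] q.2
    refine (hx 5 ((isTournament_tRel isTournament_omegaStar).nonempty_relEmbedding hr e ?_)).elim
    simp [Fin.forall_fin_two, omegaStar, e]
    grind

/-- The mirror situation, with the rows interleaved as …, f 1, g 1, f 0, g 0. Two rows running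
against this order give T_[ω], exactly one gives U_[ω*]. -/
theorem ExcludesTwelve.of_ge (hx : ExcludesTwelve r) (hr : IsTournament r)
    (hf : IsMonotoneSeq r f) (hg : IsMonotoneSeq r g) (hfg : ∀ n m, m ≤ n → r (f n) (g m))
    (hgf : ∀ n m, m < n → r (g n) (f m)) :
    (∀ n m, n < m → r (f m) (f n)) ∧ ∀ n m, n < m → r (g m) (g n) := by
  rcases hf with hf | hf <;> rcases hg with hg | hg
  · let e : ℕ × Fin 2 → V := fun q => ![f q.1, g q.1] q.2
    refine (hx 4 ((isTournament_tRel isTournament_omega).nonempty_relEmbedding hr e ?_)).elim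
    simp [Fin.forall_fin_two, omega, e]
    grind
  · let e : ℕ × Fin 2 → V := fun q => ![g (q.1 + 1), f q.1] q.2
    refine (hx 7 ((isTournament_uRel isTournament_omegaStar).nonempty_relEmbedding hr e ?_)).elim
    simp [Fin.forall_fin_two, omegaStar, e]
    grind
  · let e : ℕ × Fin 2 → V := fun q => ![f q.1, g q.1] q.2
    refine (hx 7 ((isTournament_uRel isTournament_omegaStar).nonempty_relEmbedding hr e ?_)).elim
    simp [Fin.forall_fin_two, omegaStar, e]
    grind
  · exact ⟨hf, hg⟩

end Excluded

/-! ### Unavoidability of the twelve -/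

section Excluded

variable {V : Type u} {r : V → V → Prop} {c : ℕ → ℕ → Prop}

theorem isMonotoneSeq_of_chain (hc : c = omega ∨ c = omegaStar) {f : ℕ → V}
    (hf : ∀ n m, c n m → r (f n) (f m)) : IsMonotoneSeq r f := by
  rcases hc with rfl | rfl
  · exact Or.inl hf
  · exact Or.inr fun n m h => hf m n h

theorem lt_cases (hc : c = omega ∨ c = omegaStar) {n m : ℕ} (h : n ≠ m) : c n m ∨ c m n := by
  rcases hc with rfl | rfl
  · exact isTournament_omega.complete _ _ h
  · exact isTournament_omegaStar.complete _ _ h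

/-- Homogeneous case of `ExcludesTwelve.false_of_inThreeCycle`. -/
theorem ExcludesTwelve.false_of_homogeneous (hx : ExcludesTwelve r) (hr : IsTournament r)
    (hc : c = omega ∨ c = omegaStar) {x y w : ℕ → V} (h : IsBlockChain r c x y)
    (hyw : ∀ n, r (y n) (w n)) (hwx : ∀ n, r (w n) (x n)) {σ ε ε' α β : Prop}
    (hσ : ∀ n m, n < m → (r (w n) (w m) ↔ σ)) (hε : ∀ n m, n < m → (r (w n) (x m) ↔ ε))
    (hε' : ∀ n m, n < m → (r (w n) (y m) ↔ ε')) (hα : ∀ n m, n < m → (r (w m) (x n) ↔ α))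
    (hβ : ∀ n m, n < m → (r (w m) (y n) ↔ β)) : False := by
  have hwx_ne : ∀ n m, n ≠ m → w m ≠ x n := by
    intro n m hnm he
    rcases lt_cases hc hnm with h' | h'
    · exact hr.asymm (h.xy _ _ h') (he ▸ hyw m)
    · exact hr.asymm (h.xx _ _ h') (he ▸ hwx m)
  have hwy_ne : ∀ n m, n ≠ m → w m ≠ y n := by
    intro n m hnm he
    rcases lt_cases hc hnm with h' | h'
    · exact hr.asymm (h.yy _ _ h') (he ▸ hyw m)
    · exact hr.asymm (h.xy _ _ h') (he ▸ hwx m)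
  have hshift := h.comp hc strictMono_add_one
  -- If `w 0` treated the later x's and y's differently, it would alternate along the chain and
  -- produce a V.
  have hεε' : ε ↔ ε' := by
    constructor
    · intro h1
      by_contra h2
      exact hx.false_of_v hr hc hshift (w 0) (fun n => (hε 0 (n + 1) n.succ_pos).2 h1)
        fun n => hr.of_not (hwy_ne _ _ n.succ_ne_zero) fun h' =>
          h2 ((hε' 0 (n + 1) n.succ_pos).1 h')
    · intro h1
      by_contra h2
      exact hx.false_of_v' hr hc hshift (w 0) (fun n => hr.of_not
        (hwx_ne _ _ n.succ_ne_zero) fun h' => h2 ((hε 0 (n + 1) n.succ_pos).1 h'))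
        fun n => (hε' 0 (n + 1) n.succ_pos).2 h1
  have hw : IsMonotoneSeq r w := by
    by_cases h1 : σ
    · exact Or.inl fun n m h' => (hσ n m h').2 h1
    -- A failed edge reverses only between distinct vertices. If w n = w m, then w n → x m, hence w
    -- n → y m by `hεε'`, against y m → w m.
    · refine Or.inr fun n m h' => hr.of_not (fun he => ?_) fun h2 => h1 ((hσ n m h').1 h2)
      have h2 := (hε n m h').1 (he ▸ hwx m)
      exact hr.asymm (hyw m) (he ▸ (hε' n m h').2 (hεε'.1 h2))
  have hxm := isMonotoneSeq_of_chain hc h.xx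
  have hym := isMonotoneSeq_of_chain hc h.yy
  by_cases h1 : ε
  · have hwx' : ∀ n m, n < m → r (w n) (x m) := fun n m h' => (hε n m h').2 h1
    have hwy' : ∀ n m, n < m → r (w n) (y m) := fun n m h' => (hε' n m h').2 (hεε'.1 h1)
    by_cases h2 : β
    -- Here w n dominates every y m except y n: the pattern of H or K.
    · refine hx.false_of_eq hr hym hw hyw fun n m hnm => ?_
      rcases lt_or_gt_of_ne hnm with h' | h'
      · exact hwy' n m h'
      · exact (hβ m n h').2 h2
    · have hyw' : ∀ n m, n < m → r (y n) (w m) := fun n m h' =>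
        hr.of_not (hwy_ne _ _ h'.ne) fun h'' => h2 ((hβ n m h').1 h'')
      obtain ⟨hy, hw⟩ := hx.of_le hr hym hw (fun n m h' => by
        rcases h'.lt_or_eq with h' | rfl
        · exact hyw' n m h'
        · exact hyw n) hwy'
      -- The rows y and w are interleaved and hence increase with the index, which is incompatible
      -- with a chain along ω*.
      obtain rfl : c = omega := by
        rcases hc with rfl | rfl
        · rfl
        · exact (hr.asymm (hy 0 1 one_pos) (h.yy 1 0 one_pos)).elim
      by_cases h3 : α
      -- The apex of the V is `x 0`, which precedes all later y's but follows all later w's. The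
      -- shift discards block 0.
      · exact hx.false_of_v hr hc (x := fun n => y (n + 1)) (y := fun n => w (n + 1))
          (IsBlockChain.comp hc ⟨hyw, hy, hyw', hwy', hw⟩ strictMono_add_one) (x 0)
          (fun n => h.xy _ _ n.succ_pos) fun n => (hα _ _ n.succ_pos).2 h3
      · have hxw' : ∀ n m, n < m → r (x n) (w m) := fun n m h' =>
          hr.of_not (hwx_ne _ _ h'.ne) fun h'' => h3 ((hα n m h').1 h'')
        refine hx.false_of_c3 hr hc ![x, y, w] ?_ ?_
        · intro i n
          fin_cases i
          · exact h.pair n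
          · exact hyw n
          · exact hwx n
        · intro i j n m h'
          fin_cases i <;> fin_cases j
          · exact h.xx n m h'
          · exact h.xy n m h'
          · exact hxw' n m h'
          · exact h.yx n m h'
          · exact h.yy n m h'
          · exact hyw' n m h'
          · exact hwx' n m h'
          · exact hwy' n m h'
          · exact hw n m h'
  · have hxw' : ∀ n m, n < m → r (x m) (w n) := fun n m h' =>
      hr.of_not (hwx_ne _ _ h'.ne') fun h'' => h1 ((hε n m h').1 h'')
    have hyw' : ∀ n m, n < m → r (y m) (w n) := fun n m h' =>
      hr.of_not (hwy_ne _ _ h'.ne') fun h'' => h1 (hεε'.2 ((hε' n m h').1 h''))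
    by_cases h2 : α
    · have hwx' : ∀ n m, n < m → r (w m) (x n) := fun n m h' => (hα n m h').2 h2
      obtain ⟨hw, hxx⟩ := hx.of_ge hr hw hxm (fun n m h' => by
        rcases h'.lt_or_eq with h' | rfl
        · exact hwx' m n h'
        · exact hwx m) fun n m h' => hxw' m n h'
      obtain rfl : c = omegaStar := by
        rcases hc with rfl | rfl
        · exact (hr.asymm (hxx 0 1 one_pos) (h.xx 0 1 one_pos)).elim
        · rfl
      by_cases h3 : β
      · have hwy' : ∀ n m, n < m → r (w m) (y n) := fun n m h' => (hβ n m h').2 h3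
        refine hx.false_of_c3 hr hc ![x, y, w] ?_ ?_
        · intro i n
          fin_cases i
          · exact h.pair n
          · exact hyw n
          · exact hwx n
        · intro i j n m h'
          fin_cases i <;> fin_cases j
          · exact h.xx n m h'
          · exact h.xy n m h'
          · exact hxw' m n h'
          · exact h.yx n m h'
          · exact h.yy n m h'
          · exact hyw' m n h'
          · exact hwx' m n h'
          · exact hwy' m n h'
          · exact hw m n h'
      -- Along ω* the x's of positive index precede `y 0`, while the w's of positive index follow
      -- it, so `y 0` is the apex.
      · exact hx.false_of_v hr hc (x := fun n => w (n + 1)) (y := fun n => x (n + 1))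
          (IsBlockChain.comp hc ⟨hwx, fun n m h' => hw m n h', fun n m h' => hwx' m n h',
            fun n m h' => hxw' m n h', h.xx⟩ strictMono_add_one) (y 0)
          (fun n => hr.of_not (hwy_ne _ _ n.succ_ne_zero.symm) fun h' =>
            h3 ((hβ _ _ n.succ_pos).1 h'))
          fun n => h.xy _ _ n.succ_pos
    · refine hx.false_of_eq hr hw hxm hwx fun n m hnm => ?_
      rcases lt_or_gt_of_ne hnm with h' | h'
      · exact hr.of_not (hwx_ne _ _ hnm) fun h'' => h2 ((hα n m h').1 h'')
      · exact hxw' m n h'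

theorem ExcludesTwelve.false_of_inThreeCycle (hx : ExcludesTwelve r) (hr : IsTournament r)
    (hc : c = omega ∨ c = omegaStar) {x y : ℕ → V} (h : IsBlockChain r c x y)
    (hw : ∀ n, InThreeCycle r (x n) (y n)) : False := by
  choose w hyw hwx using hw
  obtain ⟨g, hg, k, hk⟩ := exists_strictMono_homogeneous fun n m =>
    (r (w n) (w m), r (w n) (x m), r (w n) (y m), r (w m) (x n), r (w m) (y n))
  exact hx.false_of_homogeneous hr hc (h.comp hc hg) (fun n => hyw (g n)) (fun n => hwx (g n))
    (σ := k.1) (ε := k.2.1) (ε' := k.2.2.1) (α := k.2.2.2.1) (β := k.2.2.2.2)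
    (fun n m h => by rw [← hk n m h]) (fun n m h => by rw [← hk n m h])
    (fun n m h => by rw [← hk n m h]) (fun n m h => by rw [← hk n m h])
    (fun n m h => by rw [← hk n m h])

theorem exists_pairs (hc : c = omega ∨ c = omegaStar) : ∃ s t : ℕ → ℕ, (∀ n, c (s n) (t n)) ∧
    ∀ n m, c n m → c (s n) (s m) ∧ c (s n) (t m) ∧ c (t n) (s m) ∧ c (t n) (t m) := by
  rcases hc with rfl | rfl
  · refine ⟨fun n => 2 * n, fun n => 2 * n + 1, fun n => ?_, fun n m h => ?_⟩
    · simp only [omega]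
      omega
    · simp only [omega] at *
      omega
  · refine ⟨fun n => 2 * n + 1, fun n => 2 * n, fun n => ?_, fun n m h => ?_⟩
    · simp only [omegaStar]
      omega
    · simp only [omegaStar] at *
      omega

/-- Vertices inserted between the two ends of the pairs of a block chain, none of whose edges is
in a `3`-cycle, can be supposed to be stacked as well. -/
theorem ExcludesTwelve.exists_strictMono_stacked (hx : ExcludesTwelve r) (hr : IsTournament r)
    (hc : c = omega ∨ c = omegaStar) {x y : ℕ → V} (h : IsBlockChain r c x y)
    (hxx : ∀ n m, c n m → ¬ InThreeCycle r (x n) (x m))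
    (hyx : ∀ n m, c n m → ¬ InThreeCycle r (y n) (x m))
    (hyy : ∀ n m, c n m → ¬ InThreeCycle r (y n) (y m)) (z : Fin 3 → ℕ → V)
    (hxz : ∀ i n, r (x n) (z i n)) (hzy : ∀ i n, r (z i n) (y n)) :
    ∃ g : ℕ → ℕ, StrictMono g ∧ (∀ i, IsBlockChain r c (fun n => x (g n)) fun n => z i (g n)) ∧
      (∀ i, IsBlockChain r c (fun n => z i (g n)) fun n => y (g n)) ∧
      ∀ i j n m, c n m → r (z i (g n)) (z j (g m)) := by
  -- Transitivity across an edge that lies in no 3-cycle. It places each inserted vertex correctly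
  -- relative to all other blocks.
  have tr : ∀ a b d, r a b → r b d → ¬ InThreeCycle r a b → r a d := by
    intro a b d hab hbd hn
    refine hr.of_not ?_ fun h' => hn ⟨d, hbd, h'⟩
    rintro rfl
    exact hr.asymm hab hbd
  have tr' : ∀ a b d, r d a → r a b → ¬ InThreeCycle r a b → r d b := by
    intro a b d hda hab hn
    refine hr.of_not ?_ fun h' => hn ⟨d, h', hda⟩
    rintro rfl
    exact hr.asymm hab hda
  have hxz' : ∀ i n m, c n m → r (x n) (z i m) := fun i n m h' =>
    tr _ _ _ (h.xx n m h') (hxz i m) (hxx n m h')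
  have hyz' : ∀ i n m, c n m → r (y n) (z i m) := fun i n m h' =>
    tr _ _ _ (h.yx n m h') (hxz i m) (hyx n m h')
  have hzx' : ∀ i n m, c n m → r (z i n) (x m) := fun i n m h' =>
    tr' _ _ _ (hzy i n) (h.yx n m h') (hyx n m h')
  have hzy' : ∀ i n m, c n m → r (z i n) (y m) := fun i n m h' =>
    tr' _ _ _ (hzy i n) (h.yy n m h') (hyy n m h')
  have hne : ∀ i j n m, c n m → z i n ≠ z j m := by
    intro i j n m h' he
    exact hr.asymm (hzy i n) (he ▸ hyz' j n m h')
  obtain ⟨g, hg, k, hk⟩ := exists_strictMono_homogeneous fun n m i j =>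
    (r (z i n) (z j m))
  have hk' : ∀ n m, n < m → ∀ i j, r (z i (g n)) (z j (g m)) ↔ k i j := fun n m h' i j => by
    rw [← hk n m h']
  have hcg : ∀ n m, c n m → c (g n) (g m) := fun n m => map_strictMono hc hg
  have hdich : ∀ i j, (∀ n m, c n m → r (z i (g n)) (z j (g m))) ∨
      ∀ n m, c n m → r (z j (g m)) (z i (g n)) := by
    intro i j
    have hcc := hc
    rcases hcc with rfl | rfl
    · by_cases h' : k i j
      · exact Or.inl fun n m hnm => (hk' n m hnm i j).2 h'
      · exact Or.inr fun n m hnm => hr.of_not (hne _ _ _ _ (hcg _ _ hnm)) fun h'' =>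
          h' ((hk' n m hnm i j).1 h'')
    · by_cases h' : k j i
      · exact Or.inr fun n m hnm => (hk' m n hnm j i).2 h'
      · exact Or.inl fun n m hnm => hr.of_not (hne _ _ _ _ (hcg _ _ hnm)).symm fun h'' =>
          h' ((hk' m n hnm j i).1 h'')
  have hb := h.comp hc hg
  have hdiag : ∀ i n m, c n m → r (z i (g n)) (z i (g m)) := by
    intro i
    -- A reversed row of inserted vertices, interleaved with the row x, is excluded by `of_le` or
    -- `of_ge`.
    refine (hdich i i).resolve_right fun hrev => ?_
    have hxm := isMonotoneSeq_of_chain hc hb.xx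
    have hcc := hc
    rcases hcc with rfl | rfl
    · have h2 := (hx.of_le hr hxm (g := fun n => z i (g n)) (Or.inr hrev) (fun n m h' => by
        rcases h'.lt_or_eq with h' | rfl
        · exact hxz' i _ _ (hcg _ _ h')
        · exact hxz i _) fun n m h' => hzx' i _ _ (hcg _ _ h')).2
      exact hr.asymm (h2 0 1 one_pos) (hrev 0 1 one_pos)
    · have h2 := (hx.of_ge hr hxm (g := fun n => z i (g n)) (Or.inl fun n m => hrev m n)
        (fun n m h' => by
        rcases h'.lt_or_eq with h' | rfl
        · exact hxz' i _ _ (hcg _ _ h')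
        · exact hxz i _) fun n m h' => hzx' i _ _ (hcg _ _ h')).2
      exact hr.asymm (h2 0 1 one_pos) (hrev 1 0 one_pos)
  have hbz : ∀ i, IsBlockChain r c (fun n => z i (g n)) fun n => y (g n) := fun i =>
    ⟨fun n => hzy i _, hdiag i, fun n m h' => hzy' i _ _ (hcg _ _ h'),
      fun n m h' => hyz' i _ _ (hcg _ _ h'), hb.yy⟩
  refine ⟨g, hg, fun i => ⟨fun n => hxz i _, hb.xx, fun n m h' => hxz' i _ _ (hcg _ _ h'),
      fun n m h' => hzx' i _ _ (hcg _ _ h'), hdiag i⟩, hbz, fun i j => ?_⟩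
  refine (hdich i j).resolve_right fun hrev => ?_
  -- A reversed edge from a later z j back to z i n closes z i n → y n → z j m to a 3-cycle, for
  -- every block. The shift guarantees a later block along ω*, where index 0 is last.
  refine hx.false_of_inThreeCycle hr hc ((hbz i).comp hc strictMono_add_one) fun n => ?_
  obtain ⟨m, hm⟩ : ∃ m, c (n + 1) m := by
    rcases hc with rfl | rfl
    · exact ⟨n + 2, Nat.lt_succ_self _⟩
    · exact ⟨n, Nat.lt_succ_self _⟩
  exact ⟨z j (g m), hyz' j _ _ (hcg _ _ hm), hrev _ _ hm⟩

theorem not_excludesTwelve [Infinite V] (hr : IsTournament r) (hi : AcyclicallyIndecomposable r) :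
    ¬ ExcludesTwelve r := by
  intro hx
  obtain ⟨c, hc, p, hp⟩ : ∃ c : ℕ → ℕ → Prop, (c = omega ∨ c = omegaStar) ∧
      ∃ p : ℕ → V, ∀ n m, c n m → r (p n) (p m) := by
    let e := Infinite.natEmbedding V
    obtain ⟨g, hg, k, hk⟩ := exists_strictMono_homogeneous fun n m => r (e n) (e m)
    by_cases h : k
    · exact ⟨omega, Or.inl rfl, fun n => e (g n), fun n m h' => by rwa [hk n m h']⟩
    · refine ⟨omegaStar, Or.inr rfl, fun n => e (g n), fun n m h' => ?_⟩
      exact hr.of_not (fun he => (hg h').ne (e.injective he)) fun h'' => h (hk m n h' ▸ h'')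
  obtain ⟨s, t, hst, hst'⟩ := exists_pairs hc
  -- Exactly one of the two implications has a true premise, so the colour records whether the edge
  -- between `p n` and `p m`, whichever way it points, lies in a 3-cycle.
  obtain ⟨g, hg, k, hk⟩ := exists_strictMono_homogeneous fun n m =>
    (c n m → InThreeCycle r (p n) (p m)) ∧ (c m n → InThreeCycle r (p m) (p n))
  have hcg : ∀ n m, c n m → c (g n) (g m) := fun n m => map_strictMono hc hg
  have hb : IsBlockChain r c (fun n => p (g (s n))) fun n => p (g (t n)) :=
    ⟨fun n => hp _ _ (hcg _ _ (hst n)), fun n m h => hp _ _ (hcg _ _ (hst' n m h).1),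
      fun n m h => hp _ _ (hcg _ _ (hst' n m h).2.1),
      fun n m h => hp _ _ (hcg _ _ (hst' n m h).2.2.1),
      fun n m h => hp _ _ (hcg _ _ (hst' n m h).2.2.2)⟩
  have hno : ∀ n m, c n m → ¬ InThreeCycle r (p (g n)) (p (g m)) := by
    by_cases hk' : k
    · refine (hx.false_of_inThreeCycle hr hc hb fun n => ?_).elim
      rcases lt_trichotomy (s n) (t n) with h | h | h
      · exact ((hk _ _ h).mpr hk').1 (hcg _ _ (hst n))
      · have := hb.pair n
        rw [h] at this
        exact (hr.irrefl _ this).elim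
      · exact ((hk _ _ h).mpr hk').2 (hcg _ _ (hst n))
    · have asym : ∀ a b, c a b → ¬ c b a := by
        rcases hc with rfl | rfl
        · exact fun a b => isTournament_omega.asymm
        · exact fun a b => isTournament_omegaStar.asymm
      intro n m hnm hin
      rcases lt_trichotomy n m with h | rfl | h
      · exact hk' ((hk _ _ h).mp ⟨fun _ => hin, fun h' => (asym _ _ (hcg _ _ hnm) h').elim⟩)
      · exact asym _ _ hnm hnm
      · exact hk' ((hk _ _ h).mp ⟨fun h' => (asym _ _ (hcg _ _ hnm) h').elim, fun _ => hin⟩)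
  have hobs : ∀ n, ∃ z : Fin 3 → V, (∀ i, r (p (g (s n))) (z i) ∧ r (z i) (p (g (t n)))) ∧
      (InThreeCycle r (p (g (s n))) (z 0) ∨ InThreeCycle r (z 0) (p (g (t n))) ∨
        ∀ i, r (z i) (z (i + 1))) := by
    intro n
    rcases edgeObstruction_of_acyclicallyIndecomposable hr hi (hb.pair n) with
      h | ⟨z, w, h1, h2, h3, h4, h5⟩ | ⟨z, w, h1, h2, h3, h4, h5⟩ | ⟨z, h1, h2⟩
    · exact (hno _ _ (hst n) h).elim
    -- A single intermediate vertex is repeated three times so that all kinds of obstruction have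
    -- the same shape.
    · exact ⟨fun _ => z, fun _ => ⟨h1, h2⟩, Or.inl ⟨w, h5, h3⟩⟩
    · exact ⟨fun _ => z, fun _ => ⟨h1, h2⟩, Or.inr (Or.inl ⟨w, h4, h5⟩)⟩
    · exact ⟨z, h1, Or.inr (Or.inr h2)⟩
  choose z hz hz' using hobs
  obtain ⟨q, hq, hxz, hzy, hzz⟩ := hx.exists_strictMono_stacked hr hc hb
    (fun n m h => hno _ _ (hst' n m h).1) (fun n m h => hno _ _ (hst' n m h).2.2.1)
    (fun n m h => hno _ _ (hst' n m h).2.2.2) (fun i n => z n i) (fun i n => (hz n i).1)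
    (fun i n => (hz n i).2)
  -- The colour ignores the second index: this is the pigeonhole principle, making the kind of
  -- obstruction constant.
  obtain ⟨q', hq', k, hk⟩ := exists_strictMono_homogeneous fun n _ =>
    (InThreeCycle r (p (g (s (q n)))) (z (q n) 0), InThreeCycle r (z (q n) 0) (p (g (t (q n)))))
  by_cases h1 : k.1
  · refine hx.false_of_inThreeCycle hr hc ((hxz 0).comp hc hq') fun n => ?_
    rw [← hk n (n + 1) n.lt_succ_self] at h1
    exact h1
  by_cases h2 : k.2
  · refine hx.false_of_inThreeCycle hr hc ((hzy 0).comp hc hq') fun n => ?_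
    rw [← hk n (n + 1) n.lt_succ_self] at h2
    exact h2
  refine hx.false_of_c3 hr hc (fun i n => z (q (q' n)) i) (fun i n => ?_)
    fun i j n m h => hzz i j _ _ (map_strictMono hc hq' h)
  rw [← hk n (n + 1) n.lt_succ_self] at h1 h2
  exact ((hz' (q (q' n))).resolve_left h1).resolve_left h2 i

end Excluded

/-! ### Isomorphism invariants -/

section Invariants

variable {V : Type u} {W : Type v} {r : V → V → Prop} {s : W → W → Prop}

/-- The vertex `x` has finitely many in-neighbours. -/
def FiniteIn (r : V → V → Prop) (x : V) : Prop := {y | r y x}.Finite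

/-- The vertex `x` has finitely many out-neighbours. -/
def FiniteOut (r : V → V → Prop) (x : V) : Prop := {y | r x y}.Finite

/-- The vertex `x` has infinitely many in-neighbours and infinitely many out-neighbours. -/
def InfiniteInOut (r : V → V → Prop) (x : V) : Prop := ¬ FiniteIn r x ∧ ¬ FiniteOut r x

/-- Four isomorphism invariants. -/
def signature (r : V → V → Prop) : Fin 4 → Prop :=
  ![∃ x, FiniteIn r x, ∃ x, FiniteOut r x,
    ∃ x, InfiniteInOut r x ∧ ∀ y, InfiniteInOut r y → y ≠ x → r x y,
    ∃ x, InfiniteInOut r x ∧ ∀ y, InfiniteInOut r y → y ≠ x → r y x]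

/-- Every out-neighbourhood has a source. -/
def OutHasSource (r : V → V → Prop) : Prop :=
  ∀ x, ∃ y, r x y ∧ ∀ z, r x z → z ≠ y → r y z

/-- Every in-neighbourhood has a sink. -/
def InHasSink (r : V → V → Prop) : Prop :=
  ∀ x, ∃ y, r y x ∧ ∀ z, r z x → z ≠ y → r z y

theorem FiniteIn.map (e : r ≃r s) {x : V} (h : FiniteIn r x) : FiniteIn s (e x) := by
  refine (h.image e).subset fun y hy => ⟨e.symm y, ?_, e.apply_symm_apply y⟩
  change r _ _
  rw [← e.map_rel_iff, e.apply_symm_apply]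
  exact hy

theorem FiniteOut.map (e : r ≃r s) {x : V} (h : FiniteOut r x) : FiniteOut s (e x) := by
  refine (h.image e).subset fun y hy => ⟨e.symm y, ?_, e.apply_symm_apply y⟩
  change r _ _
  rw [← e.map_rel_iff, e.apply_symm_apply]
  exact hy

theorem InfiniteInOut.map (e : r ≃r s) {x : V} (h : InfiniteInOut r x) :
    InfiniteInOut s (e x) := by
  refine ⟨fun h' => h.1 ?_, fun h' => h.2 ?_⟩
  · simpa using h'.map e.symm
  · simpa using h'.map e.symm

theorem signature_map (e : r ≃r s) (k : Fin 4) (h : signature r k) : signature s k := by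
  fin_cases k
  · obtain ⟨x, hx⟩ := h
    exact ⟨e x, hx.map e⟩
  · obtain ⟨x, hx⟩ := h
    exact ⟨e x, hx.map e⟩
  · obtain ⟨x, hx, hx'⟩ := h
    refine ⟨e x, hx.map e, fun y hy hne => ?_⟩
    have := hx' (e.symm y) (hy.map e.symm) fun h => hne (by rw [← h, e.apply_symm_apply])
    rwa [← e.map_rel_iff, e.apply_symm_apply] at this
  · obtain ⟨x, hx, hx'⟩ := h
    refine ⟨e x, hx.map e, fun y hy hne => ?_⟩
    have := hx' (e.symm y) (hy.map e.symm) fun h => hne (by rw [← h, e.apply_symm_apply])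
    rwa [← e.map_rel_iff, e.apply_symm_apply] at this

theorem signature_iff (e : r ≃r s) (k : Fin 4) : signature r k ↔ signature s k :=
  ⟨signature_map e k, signature_map e.symm k⟩

theorem OutHasSource.map (e : r ≃r s) (h : OutHasSource r) : OutHasSource s := by
  intro x
  obtain ⟨y, hy, hy'⟩ := h (e.symm x)
  refine ⟨e y, by rwa [← e.map_rel_iff, e.apply_symm_apply] at hy, fun z hz hne => ?_⟩
  have := hy' (e.symm z) (by rwa [e.symm.map_rel_iff]) fun h =>
    hne (by rw [← h, e.apply_symm_apply])
  rwa [← e.map_rel_iff, e.apply_symm_apply] at this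

theorem InHasSink.map (e : r ≃r s) (h : InHasSink r) : InHasSink s := by
  intro x
  obtain ⟨y, hy, hy'⟩ := h (e.symm x)
  refine ⟨e y, by rwa [← e.map_rel_iff, e.apply_symm_apply] at hy, fun z hz hne => ?_⟩
  have := hy' (e.symm z) (by rwa [e.symm.map_rel_iff]) fun h =>
    hne (by rw [← h, e.apply_symm_apply])
  rwa [← e.map_rel_iff, e.apply_symm_apply] at this

theorem IsTournament.map (e : r ≃r s) (h : IsTournament r) : IsTournament s := by
  refine ⟨fun x => ?_, fun x y h1 h2 => ?_, fun x y hne => ?_⟩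
  · rw [← e.symm.map_rel_iff]
    exact h.irrefl _
  · exact e.symm.injective (h.antisymm _ _ (e.symm.map_rel_iff.2 h1) (e.symm.map_rel_iff.2 h2))
  · rw [← e.symm.map_rel_iff, ← e.symm.map_rel_iff (a := y)]
    exact h.complete _ _ fun h' => hne (e.symm.injective h')

theorem AcyclicallyIndecomposable.map (e : r ≃r s) (h : AcyclicallyIndecomposable r) :
    AcyclicallyIndecomposable s := by
  intro A hA hA' x hx y hy
  refine e.symm.injective (h (e ⁻¹' A) ?_ ?_ (by simpa using hx) (by simpa using hy))
  · rintro a ha b hb d hd ⟨h1, h2, h3⟩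
    exact hA _ ha _ hb _ hd ⟨e.map_rel_iff.2 h1, e.map_rel_iff.2 h2, e.map_rel_iff.2 h3⟩
  · intro a ha b hb d hd
    rw [← e.map_rel_iff, ← e.map_rel_iff (a := b)]
    exact hA' _ ha _ hb _ hd

end Invariants

/-! ### Finiteness of neighbourhoods as boundedness of indices -/

section Classification

theorem finite_iff_bounded {V : Type u} (h : V → ℕ) (hh : ∀ B, {x | h x ≤ B}.Finite)
    (P : V → Prop) : {x | P x}.Finite ↔ ∃ B, ∀ x, P x → h x ≤ B := by
  constructor
  · intro hP
    obtain ⟨B, hB⟩ := (hP.image h).bddAbove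
    exact ⟨B, fun x hx => hB ⟨x, hx, rfl⟩⟩
  · rintro ⟨B, hB⟩
    exact (hh B).subset fun x hx => hB x hx

theorem finite_prod_iff (P : ℕ × Fin 2 → Prop) :
    {x | P x}.Finite ↔ ∃ B, ∀ m, (P (m, 0) → m ≤ B) ∧ (P (m, 1) → m ≤ B) := by
  rw [finite_iff_bounded Prod.fst (fun B => ?_)]
  · simp only [Prod.forall, Fin.forall_fin_two]
  · refine ((Set.finite_Iic B).prod Set.finite_univ).subset fun x hx => ⟨hx, trivial⟩

theorem finite_prod_three_iff (P : Fin 3 × ℕ → Prop) :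
    {x | P x}.Finite ↔ ∃ B, ∀ i m, P (i, m) → m ≤ B := by
  rw [finite_iff_bounded Prod.snd (fun B => ?_)]
  · simp only [Prod.forall]
  · refine (Set.finite_univ.prod (Set.finite_Iic B)).subset fun x hx => ⟨trivial, hx⟩

theorem finite_option_iff (P : Option (ℕ × Fin 2) → Prop) :
    {x | P x}.Finite ↔ ∃ B, ∀ m, (P (some (m, 0)) → m ≤ B) ∧ (P (some (m, 1)) → m ≤ B) := by
  rw [← finite_prod_iff fun x => P (some x)]
  constructor
  · intro h
    exact h.preimage (Option.some_injective _).injOn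
  · intro h
    refine ((h.image some).insert none).subset ?_
    rintro (_ | x) hx
    · exact Or.inl rfl
    · exact Or.inr ⟨x, hx, rfl⟩

theorem finite_subtype_iff (P : {p : ℕ × Fin 2 // p ≠ (0, 1)} → Prop) :
    {x | P x}.Finite ↔ ∃ B, ∀ m, (P ⟨(m, 0), by simp⟩ → m ≤ B) ∧
      ((h : (m, 1) ≠ ((0, 1) : ℕ × Fin 2)) → P ⟨(m, 1), h⟩ → m ≤ B) := by
  rw [finite_iff_bounded (fun x => x.1.1) (fun B => ?_)]
  · simp only [Subtype.forall, Prod.forall, Fin.forall_fin_two]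
    refine exists_congr fun B => forall_congr' fun m => and_congr ?_ Iff.rfl
    simp
  · refine Set.Finite.preimage Subtype.val_injective.injOn
      (s := {x : ℕ × Fin 2 | x.1 ≤ B}) ?_
    refine ((Set.finite_Iic B).prod Set.finite_univ).subset fun x hx => ⟨hx, trivial⟩

theorem signature_of_finiteIn {V : Type u} [Nonempty V] {r : V → V → Prop}
    (h : ∀ x, FiniteIn r x) (h' : ∀ x, ¬ FiniteOut r x) :
    ∀ k, signature r k ↔ k = 0 := by
  simp [Fin.forall_fin_succ, signature, InfiniteInOut, h, h']

theorem signature_of_finiteOut {V : Type u} [Nonempty V] {r : V → V → Prop}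
    (h : ∀ x, ¬ FiniteIn r x) (h' : ∀ x, FiniteOut r x) :
    ∀ k, signature r k ↔ k = 1 := by
  simp [Fin.forall_fin_succ, signature, InfiniteInOut, h, h']

theorem signature_of_infinite {V : Type u} {r : V → V → Prop} (hr : IsTournament r)
    (h : ∀ x, ¬ FiniteIn r x) (h' : ∀ x, ¬ FiniteOut r x) : ∀ k, ¬ signature r k := by
  simp only [Fin.forall_fin_succ, signature, InfiniteInOut, h, h']
  simp
  refine ⟨fun x => ?_, fun x => ?_⟩
  · by_contra hn
    push Not at hn
    refine h x (Set.Finite.subset Set.finite_empty fun y hy => ?_)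
    exact hr.asymm hy (hn y (hr.ne hy))
  · by_contra hn
    push Not at hn
    refine h' x (Set.Finite.subset Set.finite_empty fun y hy => ?_)
    exact hr.asymm hy (hn y (hr.ne hy).symm)

end Classification

/-! ### Degrees and signatures of the twelve -/

section Signatures

theorem signature_c3Rel_omega : ∀ k, signature (c3Rel omega) k ↔ k = 0 := by
  refine signature_of_finiteIn ?_ ?_
  · rintro ⟨i, n⟩
    refine (finite_prod_three_iff _).2 ⟨n, fun j m h => ?_⟩
    simp only [c3Rel, lexProd, omega] at h
    omega
  · rintro ⟨i, n⟩ h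
    obtain ⟨B, hB⟩ := (finite_prod_three_iff _).1 h
    have := hB i (B + n + 1) (Or.inr (by simp only [omega]; omega))
    omega

theorem signature_c3Rel_omegaStar : ∀ k, signature (c3Rel omegaStar) k ↔ k = 1 := by
  refine signature_of_finiteOut ?_ ?_
  · rintro ⟨i, n⟩ h
    obtain ⟨B, hB⟩ := (finite_prod_three_iff _).1 h
    have := hB i (B + n + 1) (Or.inr (by simp only [omegaStar]; omega))
    omega
  · rintro ⟨i, n⟩
    refine (finite_prod_three_iff _).2 ⟨n, fun j m h => ?_⟩
    simp only [c3Rel, lexProd, omegaStar] at h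
    omega

theorem finiteIn_vRel_omega (x) : FiniteIn (vRel omega) x ↔ x ≠ none := by
  rw [FiniteIn, finite_option_iff]
  rcases x with _ | ⟨n, i⟩
  · refine iff_of_false (fun ⟨B, hB⟩ => ?_) (by simp)
    have := (hB (B + 1)).2 (by simp [vRel])
    omega
  · refine iff_of_true ⟨n, fun m => ?_⟩ (by simp)
    simp only [vRel, omega]
    omega

theorem not_finiteOut_vRel_omega (x) : ¬ FiniteOut (vRel omega) x := by
  rw [FiniteOut, finite_option_iff]
  rintro ⟨B, hB⟩
  rcases x with _ | ⟨n, i⟩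
  · have := (hB (B + 1)).1 (by simp [vRel])
    omega
  · have := (hB (B + n + 1)).1 (by simp only [vRel, omega]; omega)
    omega

theorem not_finiteIn_vRel_omegaStar (x) : ¬ FiniteIn (vRel omegaStar) x := by
  rw [FiniteIn, finite_option_iff]
  rintro ⟨B, hB⟩
  rcases x with _ | ⟨n, i⟩
  · have := (hB (B + 1)).2 (by simp [vRel])
    omega
  · have := (hB (B + n + 1)).1 (by simp only [vRel, omegaStar]; omega)
    omega

theorem finiteOut_vRel_omegaStar (x) : FiniteOut (vRel omegaStar) x ↔ x ≠ none := by
  rw [FiniteOut, finite_option_iff]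
  rcases x with _ | ⟨n, i⟩
  · refine iff_of_false (fun ⟨B, hB⟩ => ?_) (by simp)
    have := (hB (B + 1)).1 (by simp [vRel])
    omega
  · refine iff_of_true ⟨n, fun m => ?_⟩ (by simp)
    simp only [vRel, omegaStar]
    omega

-- The apex is the only vertex with both degrees infinite, hence trivially both source and sink
-- among such vertices.
theorem signature_vRel_omega : ∀ k, signature (vRel omega) k ↔ k ≠ 1 := by
  simp [Fin.forall_fin_succ, signature, InfiniteInOut, finiteIn_vRel_omega,
    not_finiteOut_vRel_omega]
  exact ⟨some (0, 0), by simp⟩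

theorem signature_vRel_omegaStar : ∀ k, signature (vRel omegaStar) k ↔ k ≠ 0 := by
  simp [Fin.forall_fin_succ, signature, InfiniteInOut, not_finiteIn_vRel_omegaStar,
    finiteOut_vRel_omegaStar]
  exact ⟨some (0, 0), by simp⟩

theorem not_finiteIn_tRel_omega (x) : ¬ FiniteIn (tRel omega) x := by
  rw [FiniteIn, finite_prod_iff]
  rintro ⟨B, hB⟩
  obtain ⟨n, i⟩ := x
  revert i
  simp only [Fin.forall_fin_two, tRel_zero_zero, tRel_zero_one, tRel_one_zero, tRel_one_one, omega]
  refine ⟨fun hB => ?_, fun hB => ?_⟩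
  all_goals
    have := hB (B + n + 1)
    omega

theorem not_finiteOut_tRel_omega (x) : ¬ FiniteOut (tRel omega) x := by
  rw [FiniteOut, finite_prod_iff]
  rintro ⟨B, hB⟩
  obtain ⟨n, i⟩ := x
  revert i
  simp only [Fin.forall_fin_two, tRel_zero_zero, tRel_zero_one, tRel_one_zero, tRel_one_one, omega]
  refine ⟨fun hB => ?_, fun hB => ?_⟩
  all_goals
    have := hB (B + n + 1)
    omega

theorem not_finiteIn_tRel_omegaStar (x) : ¬ FiniteIn (tRel omegaStar) x := by
  rw [FiniteIn, finite_prod_iff]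
  rintro ⟨B, hB⟩
  obtain ⟨n, i⟩ := x
  revert i
  simp only [Fin.forall_fin_two, tRel_zero_zero, tRel_zero_one, tRel_one_zero, tRel_one_one,
    omegaStar]
  refine ⟨fun hB => ?_, fun hB => ?_⟩
  all_goals
    have := hB (B + n + 1)
    omega

theorem not_finiteOut_tRel_omegaStar (x) : ¬ FiniteOut (tRel omegaStar) x := by
  rw [FiniteOut, finite_prod_iff]
  rintro ⟨B, hB⟩
  obtain ⟨n, i⟩ := x
  revert i
  simp only [Fin.forall_fin_two, tRel_zero_zero, tRel_zero_one, tRel_one_zero, tRel_one_one,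
    omegaStar]
  refine ⟨fun hB => ?_, fun hB => ?_⟩
  all_goals
    have := hB (B + n + 1)
    omega

theorem not_finiteIn_kTruncRel (x) : ¬ FiniteIn kTruncRel x := by
  rw [FiniteIn, finite_subtype_iff]
  rintro ⟨B, hB⟩
  obtain ⟨⟨n, i⟩, hx⟩ := x
  have h := (hB (B + n + 1)).2 (by simp)
  clear hB
  revert i
  simp only [Fin.forall_fin_two, kTruncRel, kRel_one_zero, kRel_one_one, omega]
  omega

theorem not_finiteOut_kTruncRel (x) : ¬ FiniteOut kTruncRel x := by
  rw [FiniteOut, finite_subtype_iff]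
  rintro ⟨B, hB⟩
  obtain ⟨⟨n, i⟩, hx⟩ := x
  have h := (hB (B + n + 1)).1
  clear hB
  revert i
  simp only [Fin.forall_fin_two, kTruncRel, kRel_one_zero, kRel_zero_zero, omega]
  omega

theorem finiteIn_uRel_omega (x) : FiniteIn (uRel omega) x ↔ x.2 = 0 := by
  rw [FiniteIn, finite_prod_iff]
  obtain ⟨n, i⟩ := x
  revert i
  simp only [Fin.forall_fin_two, uRel_zero_zero, uRel_zero_one, uRel_one_zero, uRel_one_one, omega]
  refine ⟨iff_of_true ⟨n, by omega⟩ trivial, iff_of_false (fun ⟨B, hB⟩ => ?_) (by simp)⟩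
  have := hB (B + n + 1)
  omega

theorem not_finiteOut_uRel_omega (x) : ¬ FiniteOut (uRel omega) x := by
  rw [FiniteOut, finite_prod_iff]
  rintro ⟨B, hB⟩
  obtain ⟨n, i⟩ := x
  revert i
  simp only [Fin.forall_fin_two, uRel_zero_zero, uRel_zero_one, uRel_one_zero, uRel_one_one, omega]
  refine ⟨fun hB => ?_, fun hB => ?_⟩
  all_goals
    have := hB (B + n + 1)
    omega

theorem not_finiteIn_uRel_omegaStar (x) : ¬ FiniteIn (uRel omegaStar) x := by
  rw [FiniteIn, finite_prod_iff]
  rintro ⟨B, hB⟩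
  obtain ⟨n, i⟩ := x
  revert i
  simp only [Fin.forall_fin_two, uRel_zero_zero, uRel_zero_one, uRel_one_zero, uRel_one_one,
    omegaStar]
  refine ⟨fun hB => ?_, fun hB => ?_⟩
  all_goals
    have := hB (B + n + 1)
    omega

theorem finiteOut_uRel_omegaStar (x) : FiniteOut (uRel omegaStar) x ↔ x.2 = 0 := by
  rw [FiniteOut, finite_prod_iff]
  obtain ⟨n, i⟩ := x
  revert i
  simp only [Fin.forall_fin_two, uRel_zero_zero, uRel_zero_one, uRel_one_zero, uRel_one_one,
    omegaStar]
  refine ⟨iff_of_true ⟨n, by omega⟩ trivial, iff_of_false (fun ⟨B, hB⟩ => ?_) (by simp)⟩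
  have := hB (B + n + 1)
  omega

theorem finiteIn_hRel_omega (x) : FiniteIn (hRel omega) x ↔ x.2 = 1 := by
  rw [FiniteIn, finite_prod_iff]
  obtain ⟨n, i⟩ := x
  revert i
  simp only [Fin.forall_fin_two, hRel_zero_zero, hRel_zero_one, hRel_one_zero, hRel_one_one, omega]
  refine ⟨iff_of_false (fun ⟨B, hB⟩ => ?_) (by simp), iff_of_true ⟨n, by omega⟩ trivial⟩
  have := hB (B + n + 1)
  omega

theorem not_finiteOut_hRel_omega (x) : ¬ FiniteOut (hRel omega) x := by
  rw [FiniteOut, finite_prod_iff]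
  rintro ⟨B, hB⟩
  obtain ⟨n, i⟩ := x
  revert i
  simp only [Fin.forall_fin_two, hRel_zero_zero, hRel_zero_one, hRel_one_zero, hRel_one_one, omega]
  refine ⟨fun hB => ?_, fun hB => ?_⟩
  all_goals
    have := hB (B + n + 1)
    omega

theorem not_finiteIn_hRel_omegaStar (x) : ¬ FiniteIn (hRel omegaStar) x := by
  rw [FiniteIn, finite_prod_iff]
  rintro ⟨B, hB⟩
  obtain ⟨n, i⟩ := x
  revert i
  simp only [Fin.forall_fin_two, hRel_zero_zero, hRel_zero_one, hRel_one_zero, hRel_one_one,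
    omegaStar]
  refine ⟨fun hB => ?_, fun hB => ?_⟩
  all_goals
    have := hB (B + n + 1)
    omega

theorem finiteOut_hRel_omegaStar (x) : FiniteOut (hRel omegaStar) x ↔ x.2 = 0 := by
  rw [FiniteOut, finite_prod_iff]
  obtain ⟨n, i⟩ := x
  revert i
  simp only [Fin.forall_fin_two, hRel_zero_zero, hRel_zero_one, hRel_one_zero, hRel_one_one,
    omegaStar]
  refine ⟨iff_of_true ⟨n, by omega⟩ trivial, iff_of_false (fun ⟨B, hB⟩ => ?_) (by simp)⟩
  have := hB (B + n + 1)
  omega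

theorem finiteIn_kRel_omegaStar (x) : FiniteIn (kRel omegaStar) x ↔ x.2 = 1 := by
  rw [FiniteIn, finite_prod_iff]
  obtain ⟨n, i⟩ := x
  revert i
  simp only [Fin.forall_fin_two, kRel_zero_zero, kRel_zero_one, kRel_one_zero, kRel_one_one,
    omegaStar]
  refine ⟨iff_of_false (fun ⟨B, hB⟩ => ?_) (by simp), iff_of_true ⟨n, by omega⟩ trivial⟩
  have := hB (B + n + 1)
  omega

theorem finiteOut_kRel_omegaStar (x) : FiniteOut (kRel omegaStar) x ↔ x.2 = 0 := by
  rw [FiniteOut, finite_prod_iff]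
  obtain ⟨n, i⟩ := x
  revert i
  simp only [Fin.forall_fin_two, kRel_zero_zero, kRel_zero_one, kRel_one_zero, kRel_one_one,
    omegaStar]
  refine ⟨iff_of_true ⟨n, by omega⟩ trivial, iff_of_false (fun ⟨B, hB⟩ => ?_) (by simp)⟩
  have := hB (B + n + 1)
  omega

theorem signature_uRel_omega : ∀ k, signature (uRel omega) k ↔ k = 0 ∨ k = 3 := by
  simp [Fin.forall_fin_succ, signature, InfiniteInOut, finiteIn_uRel_omega,
    not_finiteOut_uRel_omega, Fin.exists_fin_two, omega]
  refine ⟨fun n => ⟨n + 1, by omega, by omega⟩, 0, fun m h => by omega⟩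

theorem signature_uRel_omegaStar : ∀ k, signature (uRel omegaStar) k ↔ k = 1 ∨ k = 2 := by
  simp [Fin.forall_fin_succ, signature, InfiniteInOut, not_finiteIn_uRel_omegaStar,
    finiteOut_uRel_omegaStar, Fin.exists_fin_two, omegaStar]
  refine ⟨⟨0, fun m h => by omega⟩, fun n => ⟨n + 1, by omega, by omega⟩⟩

theorem signature_hRel_omega : ∀ k, signature (hRel omega) k ↔ k = 0 ∨ k = 2 := by
  simp [Fin.forall_fin_succ, signature, InfiniteInOut, finiteIn_hRel_omega,
    not_finiteOut_hRel_omega, Fin.exists_fin_two, omega]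
  refine ⟨⟨0, fun m h => by omega⟩, fun n => ⟨n + 1, by omega, by omega⟩⟩

theorem signature_hRel_omegaStar : ∀ k, signature (hRel omegaStar) k ↔ k = 1 ∨ k = 3 := by
  simp [Fin.forall_fin_succ, signature, InfiniteInOut, not_finiteIn_hRel_omegaStar,
    finiteOut_hRel_omegaStar, Fin.exists_fin_two, omegaStar]
  refine ⟨fun n => ⟨n + 1, by omega, by omega⟩, 0, fun m h => by omega⟩

theorem signature_kRel_omegaStar : ∀ k, signature (kRel omegaStar) k ↔ k = 0 ∨ k = 1 := by
  simp [Fin.forall_fin_succ, signature, InfiniteInOut, finiteIn_kRel_omegaStar,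
    finiteOut_kRel_omegaStar, Fin.exists_fin_two]

end Signatures

/-! ### Separating the three tournaments with all degrees infinite -/

section Circular

theorem outHasSource_tRel_omega : OutHasSource (tRel omega) := by
  rintro ⟨n, i⟩
  revert i
  simp only [Fin.forall_fin_two]
  refine ⟨⟨(n + 1, 0), ?_⟩, ⟨(n + 1, 1), ?_⟩⟩
  all_goals
    simp [Prod.forall, Fin.forall_fin_two, omega]
    omega

theorem inHasSink_tRel_omegaStar : InHasSink (tRel omegaStar) := by
  rintro ⟨n, i⟩
  revert i
  simp only [Fin.forall_fin_two]
  refine ⟨⟨(n + 1, 0), ?_⟩, ⟨(n + 1, 1), ?_⟩⟩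
  all_goals
    simp [Prod.forall, Fin.forall_fin_two, omegaStar]
    omega

/-- The out-neighbours of (0, 0) are the vertices (n, 1), ordered as ω*, which has no first element.
-/
theorem not_outHasSource_tRel_omegaStar : ¬ OutHasSource (tRel omegaStar) := by
  intro h
  obtain ⟨⟨n, i⟩, h1, h2⟩ := h (0, 0)
  have h3 := h2 (n + 1, 1)
  clear h2
  revert i
  simp [Fin.forall_fin_two, omegaStar]

/-- The out-neighbourhood of (2, 1) contains the 3-cycle (0, 0) → (1, 0) → (1, 1) → (0, 0), and its
other members are dominated by (0, 0). -/
theorem not_outHasSource_kTruncRel : ¬ OutHasSource kTruncRel := by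
  intro h
  obtain ⟨⟨⟨n, i⟩, hne⟩, h1, h2⟩ := h ⟨(2, 1), by simp⟩
  have h3 := h2 ⟨(0, 0), by simp⟩
  have h4 := h2 ⟨(1, 0), by simp⟩
  have h5 := h2 ⟨(1, 1), by simp⟩
  clear h2
  revert i
  simp [Fin.forall_fin_two, kTruncRel, omega]
  omega

/-- The same 3-cycle lies in the in-neighbourhood of (2, 0), whose other members all dominate (0,
0). -/
theorem not_inHasSink_kTruncRel : ¬ InHasSink kTruncRel := by
  intro h
  obtain ⟨⟨⟨n, i⟩, hne⟩, h1, h2⟩ := h ⟨(2, 0), by simp⟩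
  have h3 := h2 ⟨(0, 0), by simp⟩
  have h4 := h2 ⟨(1, 0), by simp⟩
  have h5 := h2 ⟨(1, 1), by simp⟩
  clear h2
  revert i
  simp [Fin.forall_fin_two, kTruncRel, omega]
  omega

end Circular

/-! ### Assembling the statements about the twelve -/

section Twelve

theorem forall_fin_twelve {P : Fin 12 → Prop} (h0 : P 0) (h1 : P 1) (h2 : P 2) (h3 : P 3)
    (h4 : P 4) (h5 : P 5) (h6 : P 6) (h7 : P 7) (h8 : P 8) (h9 : P 9) (h10 : P 10)
    (h11 : P 11) (i : Fin 12) : P i := by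
  fin_cases i <;> assumption

theorem twelve_countable : ∀ i, Countable (twelve i).1 := by
  have h1 : Countable (Fin 3 × ℕ) := inferInstance
  have h2 : Countable (Option (ℕ × Fin 2)) := inferInstance
  have h3 : Countable (ℕ × Fin 2) := inferInstance
  obtain ⟨e⟩ := nonempty_kTruncRel_relIso
  exact forall_fin_twelve h1 h1 h2 h2 h3 h3 h3 h3 h3 h3 (e.symm.injective.countable) h3

theorem twelve_infinite : ∀ i, Infinite (twelve i).1 := by
  have h1 : Infinite (Fin 3 × ℕ) := inferInstance
  have h2 : Infinite (Option (ℕ × Fin 2)) := inferInstance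
  have h3 : Infinite (ℕ × Fin 2) := inferInstance
  obtain ⟨e⟩ := nonempty_kTruncRel_relIso
  have h4 : Function.Injective fun n : ℕ => e ⟨(n, 0), by simp⟩ := by
    intro n m h
    have := e.injective h
    simpa using this
  exact forall_fin_twelve h1 h1 h2 h2 h3 h3 h3 h3 h3 h3 (Infinite.of_injective _ h4) h3

theorem twelve_isTournament : ∀ i, IsTournament (twelve i).2 := by
  have h := isTournament_omega
  have h' := isTournament_omegaStar
  obtain ⟨e⟩ := nonempty_kTruncRel_relIso
  exact forall_fin_twelve (isTournament_c3Rel h) (isTournament_c3Rel h') (isTournament_vRel h)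
    (isTournament_vRel h') (isTournament_tRel h) (isTournament_tRel h') (isTournament_uRel h)
    (isTournament_uRel h') (isTournament_hRel h) (isTournament_hRel h')
    (isTournament_kTruncRel.map e) (isTournament_kRel h')

theorem twelve_acyclicallyIndecomposable : ∀ i, AcyclicallyIndecomposable (twelve i).2 := by
  have h := isTournament_omega
  have h' := isTournament_omegaStar
  have hn : ∀ x, ∃ y, omega x y := fun x => ⟨x + 1, Nat.lt_succ_self x⟩
  have hn' : ∀ x, ∃ y, omegaStar y x := fun x => ⟨x + 1, Nat.lt_succ_self x⟩
  have hd : ∀ x y, ∃ z, omega x z ∧ omega y z := fun x y =>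
    ⟨x + y + 1, by simp only [omega]; omega⟩
  have hd' : ∀ x y, ∃ z, omegaStar z x ∧ omegaStar z y := fun x y =>
    ⟨x + y + 1, by simp only [omegaStar]; omega⟩
  obtain ⟨e⟩ := nonempty_kTruncRel_relIso
  exact forall_fin_twelve (acyclicallyIndecomposable_c3Rel h) (acyclicallyIndecomposable_c3Rel h')
    (acyclicallyIndecomposable_vRel h) (acyclicallyIndecomposable_vRel h')
    (acyclicallyIndecomposable_tRel h (Or.inl hn) fun x y z => Nat.lt_trans)
    (acyclicallyIndecomposable_tRel h' (Or.inr hn') fun x y z h1 h2 => Nat.lt_trans h2 h1)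
    (acyclicallyIndecomposable_uRel h (Or.inl hn)) (acyclicallyIndecomposable_uRel h' (Or.inr hn'))
    (acyclicallyIndecomposable_hRel h (Or.inl hd)) (acyclicallyIndecomposable_hRel h' (Or.inr hd'))
    (acyclicallyIndecomposable_kTruncRel.map e) (acyclicallyIndecomposable_kRel h' hn')

/-- The set of `k` for which the invariant `signature _ k` holds in each of the twelve. -/
def signatureTable : Fin 12 → Finset (Fin 4) :=
  ![{0}, {1}, {0, 2, 3}, {1, 2, 3}, ∅, ∅, {0, 3}, {1, 2}, {0, 2}, {1, 3}, ∅, {0, 1}]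

theorem signature_twelve : ∀ i k, signature (twelve i).2 k ↔ k ∈ signatureTable i := by
  have h := isTournament_omega
  have h' := isTournament_omegaStar
  obtain ⟨e⟩ := nonempty_kTruncRel_relIso
  have conv : ∀ {p : Fin 4 → Prop} {s : Finset (Fin 4)} {q : Fin 4 → Prop},
      (∀ k, p k ↔ q k) → (∀ k, q k ↔ k ∈ s) → ∀ k, p k ↔ k ∈ s :=
    fun h1 h2 k => (h1 k).trans (h2 k)
  have hT := signature_of_infinite (isTournament_tRel h) not_finiteIn_tRel_omega
    not_finiteOut_tRel_omega
  have hT' := signature_of_infinite (isTournament_tRel h') not_finiteIn_tRel_omegaStar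
    not_finiteOut_tRel_omegaStar
  have hK := signature_of_infinite isTournament_kTruncRel not_finiteIn_kTruncRel
    not_finiteOut_kTruncRel
  exact forall_fin_twelve
    (conv signature_c3Rel_omega (by decide))
    (conv signature_c3Rel_omegaStar (by decide))
    (conv signature_vRel_omega (by decide))
    (conv signature_vRel_omegaStar (by decide))
    (fun k => iff_of_false (hT k) (Finset.notMem_empty k))
    (fun k => iff_of_false (hT' k) (Finset.notMem_empty k))
    (conv signature_uRel_omega (by decide))
    (conv signature_uRel_omegaStar (by decide))
    (conv signature_hRel_omega (by decide))
    (conv signature_hRel_omegaStar (by decide))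
    (fun k => iff_of_false (fun h => hK k ((signature_iff e k).2 h)) (Finset.notMem_empty k))
    (conv signature_kRel_omegaStar (by decide))

theorem twelve_not_iso (i j : Fin 12) (hij : i ≠ j) :
    IsEmpty ((twelve i).2 ≃r (twelve j).2) := by
  refine ⟨fun e => ?_⟩
  have ht : signatureTable i = signatureTable j := by
    ext k
    rw [← signature_twelve, ← signature_twelve]
    exact signature_iff e k
  -- The only repeated entry of the table is the empty set, at T_[ω], T_[ω*] and the quotient of
  -- K_[ω].
  have hcases : ∀ i j : Fin 12, i ≠ j → signatureTable i = signatureTable j →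
      (i = 4 ∧ j = 5 ∨ i = 5 ∧ j = 4) ∨ (i = 4 ∧ j = 10 ∨ i = 10 ∧ j = 4) ∨
        (i = 5 ∧ j = 10 ∨ i = 10 ∧ j = 5) := by
    decide
  obtain ⟨eK⟩ := nonempty_kTruncRel_relIso
  rcases hcases i j hij ht with (⟨rfl, rfl⟩ | ⟨rfl, rfl⟩) | (⟨rfl, rfl⟩ | ⟨rfl, rfl⟩) |
    (⟨rfl, rfl⟩ | ⟨rfl, rfl⟩)
  · exact not_outHasSource_tRel_omegaStar (outHasSource_tRel_omega.map e)
  · exact not_outHasSource_tRel_omegaStar (outHasSource_tRel_omega.map e.symm)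
  · exact not_outHasSource_kTruncRel ((outHasSource_tRel_omega.map e).map eK.symm)
  · exact not_outHasSource_kTruncRel ((outHasSource_tRel_omega.map e.symm).map eK.symm)
  · exact not_inHasSink_kTruncRel ((inHasSink_tRel_omegaStar.map e).map eK.symm)
  · exact not_inHasSink_kTruncRel ((inHasSink_tRel_omegaStar.map e.symm).map eK.symm)

end Twelve

end Morphology

theorem theorem2 :
    (∀ i : Fin 12,
      Countable (Morphology.twelve i).1 ∧ Infinite (Morphology.twelve i).1 ∧
      Morphology.IsTournament (Morphology.twelve i).2 ∧
      Morphology.AcyclicallyIndecomposable (Morphology.twelve i).2) ∧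
    (∀ i j : Fin 12, i ≠ j →
      IsEmpty ((Morphology.twelve i).2 ≃r (Morphology.twelve j).2)) ∧
    (∀ (V : Type u) (r : V → V → Prop),
      Infinite V → Morphology.IsTournament r → Morphology.AcyclicallyIndecomposable r →
      ∃ i : Fin 12, Nonempty ((Morphology.twelve i).2 ↪r r)) := by
  refine ⟨fun i => ⟨Morphology.twelve_countable i, Morphology.twelve_infinite i,
    Morphology.twelve_isTournament i, Morphology.twelve_acyclicallyIndecomposable i⟩,
    Morphology.twelve_not_iso, fun V r _ hr hi => ?_⟩
  have := Morphology.not_excludesTwelve hr hi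
  simpa only [Morphology.ExcludesTwelve, not_forall, not_not] using this
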